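/- Let $\mathbf E_0,\mathbf B_0:\mathbb R^3\to\mathbb R^3$ be real analytic, divergence-free vector fields, put $\mathbf F_0=\mathbf E_0+i\mathbf B_0$ (the Riemann–Silberstein vector), and write $\mathbf X\cdot\mathbf Y=\sum_k X_kY_k$ for the complex bilinear product on $\mathbb C^3$. Let $J=[0,\infty)$ or $J=\mathbb R$, and let $r$ be an order of differentiability, $1\le r\le\infty$ or $r=\omega$. A solution of Maxwell's equations in free space ($c=1$) on $J$ is a pair of $C^r$ fields $\mathbf E,\mathbf B:J\times\mathbb R^3\to\mathbb R^3$ with $$\nabla\cdot\mathbf E=\nabla\cdot\mathbf B=0,\qquad \partial_t\mathbf E=\nabla\times\mathbf B,\qquad \partial_t\mathbf B=-\nabla\times\mathbf E ;$$ put $\mathbf F=\mathbf E+i\mathbf B$. The field is null at time $t$ if $\mathbf F\cdot\mathbf F=0$ at time $t$ on all of $\mathbb R^3$ (equivalently $\mathbf E\cdot\mathbf B=0$ and $\mathbf E\cdot\mathbf E=\mathbf B\cdot\mathbf B$). 1. For every solution on $J$ with $\mathbf E|_{t=0}=\mathbf E_0$, $\mathbf B|_{t=0}=\mathbf B_0$,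 $$\mathbf F_0\cdot\mathbf F_0=0\ \text{ and }\ \mathbf F_0\cdot(\nabla\times\mathbf F_0)=0\ \text{ on }\mathbb R^3\quad\Longleftrightarrow\quad \mathbf F\cdot\mathbf F=0\ \text{ on } J\times\mathbb R^3 .$$ 2. The data $\mathbf F_0$ give rise to a global null solution, i.e. there is a solution on $J$ with these initial data that is null at all times $t\in J$, if and only if $\mathbf F_0\cdot\mathbf F_0=0$ and $\mathbf F_0\cdot(\nabla\times\mathbf F_0)=0$ on $\mathbb R^3$. 3. Suppose $\mathbf F_0\cdot\mathbf F_0=0$ on $\mathbb R^3$, and let $\mathbf V_0=(\mathbf E_0\times\mathbf B_0)/W_0$, $W_0=\tfrac12(\mathbf E_0^2+\mathbf B_0^2)$, be the normalized Poynting field. At each point the following are equivalent (at points with $W_0=0$, where $\mathbf E_0=\mathbf B_0=0$, all three hold trivially): * the shear-free conditions $\sum_{i,j}(E_0^iE_0^j-B_0^iB_0^j)\,\partial_jV_{0i}=0$ and $\sum_{i,j}(E_0^iB_0^j+E_0^jB_0^i)\,\partial_jV_{0i}=0$; * the conformal-foliation conditions $\mathbf V_0\cdot[(\mathbf E_0\cdot\nabla)\mathbf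 B_0+(\mathbf B_0\cdot\nabla)\mathbf E_0]=0$ and $\mathbf V_0\cdot[(\mathbf E_0\cdot\nabla)\mathbf E_0-(\mathbf B_0\cdot\nabla)\mathbf B_0]=0$; * $\mathbf F_0\cdot(\nabla\times\mathbf F_0)=0$. -/

import Mathlib

open scoped ContDiff

noncomputable section

namespace NullLight

/-- Points of physical space `ℝ³`. -/
abbrev Space : Type := EuclideanSpace ℝ (Fin 3)

/-- The partial derivative `∂ⱼ f` at `x`. -/
def pd {A : Type*} [NormedAddCommGroup A] [NormedSpace ℝ A]
    (j : Fin 3) (f : Space → A) (x : Space) : A :=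
  fderiv ℝ f x (EuclideanSpace.single j (1 : ℝ))

/-- The divergence `∇ · f` of a (real or complex) vector field on `ℝ³`. -/
def div {A : Type*} [NormedAddCommGroup A] [NormedSpace ℝ A]
    (f : Space → Fin 3 → A) (x : Space) : A :=
  ∑ i, pd i (fun y => f y i) x

/-- The curl `∇ × f` of a (real or complex) vector field on `ℝ³`. -/
def curl {A : Type*} [NormedAddCommGroup A] [NormedSpace ℝ A]
    (f : Space → Fin 3 → A) (x : Space) : Fin 3 → A :=
  ![pd 1 (fun y => f y 2) x - pd 2 (fun y => f y 1) x,
    pd 2 (fun y => f y 0) x - pd 0 (fun y => f y 2) x,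
    pd 0 (fun y => f y 1) x - pd 1 (fun y => f y 0) x]

/-- The derivative `((a · ∇) f)(x)` of a vector field along the vector `a`. -/
def along (a : Fin 3 → ℝ) (f : Space → Fin 3 → ℝ) (x : Space) : Fin 3 → ℝ :=
  fun i => ∑ j, a j * pd j (fun y => f y i) x

/-- The Riemann–Silberstein vector `F = E + i B`. -/
def rs (E B : Space → Fin 3 → ℝ) (x : Space) : Fin 3 → ℂ :=
  fun i => (E x i : ℂ) + Complex.I * (B x i : ℂ)

/-- `F · F = 0` at every point; `⬝ᵥ` is complex bilinear, without conjugation. -/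
def IsNull (E B : Space → Fin 3 → ℝ) : Prop :=
  ∀ x, rs E B x ⬝ᵥ rs E B x = 0

/-- Energy density `W = (E² + B²) / 2`. -/
def energy (E B : Space → Fin 3 → ℝ) (x : Space) : ℝ :=
  (E x ⬝ᵥ E x + B x ⬝ᵥ B x) / 2

/-- Normalized Poynting field `V = (E × B) / W` (equal to `0` where `W = 0`). -/
def poynting (E B : Space → Fin 3 → ℝ) (x : Space) : Fin 3 → ℝ :=
  (energy E B x)⁻¹ • crossProduct (E x) (B x)

/-- The shear-free conditions at `x`. Both hold trivially where `E = B = 0`, whatever the value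
of the derivative of `V` there. -/
def ShearFreeAt (E B : Space → Fin 3 → ℝ) (x : Space) : Prop :=
  (∑ i, ∑ j, (E x i * E x j - B x i * B x j) * pd j (fun y => poynting E B y i) x = 0) ∧
  (∑ i, ∑ j, (E x i * B x j + E x j * B x i) * pd j (fun y => poynting E B y i) x = 0)

/-- The conformal-foliation conditions at `x`. -/
def ConformalFoliationAt (E B : Space → Fin 3 → ℝ) (x : Space) : Prop :=
  (poynting E B x ⬝ᵥ (along (E x) B x + along (B x) E x) = 0) ∧
  (poynting E B x ⬝ᵥ (along (E x) E x - along (B x) B x) = 0)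

/-- `(E, B)` is a solution of class `C^r` of Maxwell's equations in free space (`c = 1`) for
times in the interval `J`. At an end point of `J` the time derivative is one-sided. -/
structure IsMaxwellSolution (r : WithTop ℕ∞) (J : Set ℝ)
    (E B : ℝ → Space → Fin 3 → ℝ) : Prop where
  contDiffOn_E : ContDiffOn ℝ r (fun p : ℝ × Space => E p.1 p.2) (J ×ˢ Set.univ)
  contDiffOn_B : ContDiffOn ℝ r (fun p : ℝ × Space => B p.1 p.2) (J ×ˢ Set.univ)
  div_E : ∀ t ∈ J, ∀ x, div (E t) x = 0
  div_B : ∀ t ∈ J, ∀ x, div (B t) x = 0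
  ampere : ∀ t ∈ J, ∀ x, derivWithin (fun s => E s x) J t = curl (B t) x
  faraday : ∀ t ∈ J, ∀ x, derivWithin (fun s => B s x) J t = -curl (E t) x

end NullLight

end

/-! Put `N = F · F`. Maxwell's equations read `∂ₜF = -i ∇ × F`, so `∂ₜN = -2i F · (∇ × F)`: the two
conditions on the data say exactly that `N` and `∂ₜN` vanish at `t = 0`. Necessity follows at once.

For sufficiency, every component of `F` solves the wave equation, so `(∂ₜ² - Δ)N` is a quadratic
form in first derivatives of `F`. By the algebraic identity `null_identity`, which uses `∇ · F = 0`,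
its product with `Fₖ²` is a combination of `N`, `∇N` and `F · (∇ × F)`. Hence `Fₖ² (∂ₜ² - Δ)N = αN +
γ ∂ₜN + Σ βⱼ ∂ⱼN` with continuous coefficients (`exists_wave_equation_sqF`). This equation
degenerates where `Fₖ = 0`, and analyticity makes up for that: if `N = t^(n+2) M`, comparing powers
of `t` gives `Fₖ² M = 0` at `t = 0`, so `M(0, ·)` vanishes on a nonempty open set, hence everywhere,
and one more factor `t` splits off. Thus `N` vanishes to infinite order at `t = 0`, so identically
(`sqF_eq_zero`). If the data vanish identically, uniqueness gives `F = 0`.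

The argument needs a field analytic in space-time, whereas a given solution is only `C^r`. A
Kirchhoff-type formula, written with means over a fixed ball so that `analyticOnNhd_integral_comp`
applies, yields an analytic solution on all of space-time (`analyticMaxwell_sol`). An energy
estimate in backward light cones gives uniqueness (`IsMaxwellSolution.unique`), so every solution
coincides with the analytic one.

The pointwise equivalences are vector calculus: differentiate `V · E = V · B = 0` for the first, `E
· B = 0` and `E² = B²` for the second. -/

noncomputable section

namespace NullLight

open MeasureTheory Filter Topology
open scoped NNReal ENNReal

/-! ### Integrals of analytic functions depending on parameters. -/

section ParametricAnalytic

variable {E H F : Type*} [NormedAddCommGroup E] [NormedSpace ℝ E]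
  [NormedAddCommGroup H] [NormedSpace ℝ H] [NormedAddCommGroup F] [NormedSpace ℝ F]

/-- Near a point of analyticity the power series of `f` converge, with uniform bounds, on balls of
a fixed radius. -/
lemma exists_uniform_powerSeries [CompleteSpace F] {f : H → F} {z₀ : H}
    (hf : AnalyticAt ℝ f z₀) :
    ∃ r : ℝ≥0, 0 < r ∧ ∃ A : ℝ, ∀ᶠ z in 𝓝 z₀, ∃ q : FormalMultilinearSeries ℝ H F,
      HasFPowerSeriesOnBall f q z r ∧ ∀ n, ‖q n‖ * (r : ℝ) ^ n ≤ A := by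
  obtain ⟨p, R, hp⟩ := hf
  obtain ⟨R', hR'0, hR'⟩ := ENNReal.lt_iff_exists_nnreal_btwn.1 hp.r_pos
  have hR'pos : 0 < R' := by exact_mod_cast hR'0
  -- Half the radius: recentring at a point within `r` of `z₀` leaves a ball of radius `r`. Since
  -- `2r` is below the radius of convergence, the double series of the recentred coefficients
  -- converges, and its sum serves as the uniform bound.
  set r : ℝ≥0 := R' / 2 with hr
  have hrr : r + r = R' := add_halves R'
  have hrpos : 0 < r := half_pos hR'pos
  have hrad : ((r : ℝ≥0∞) + r) < p.radius := by
    rw [← ENNReal.coe_add, hrr]; exact hR'.trans_le hp.r_le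
  have hsum := p.changeOriginSeries_summable_aux₁ hrad
  have hS := (NNReal.summable_sigma.1 hsum).2
  refine ⟨r, hrpos, ((∑' k, ∑' s : Σ l : ℕ, { s : Finset (Fin (k + l)) // s.card = l },
    ‖p (k + s.1)‖₊ * r ^ s.1 * r ^ k : ℝ≥0) : ℝ), ?_⟩
  filter_upwards [Metric.ball_mem_nhds z₀ (show (0 : ℝ) < r from hrpos)] with z hz
  have hz' : ‖z - z₀‖₊ < r := by
    rw [← NNReal.coe_lt_coe, coe_nnnorm, ← dist_eq_norm]; exact hz
  refine ⟨p.changeOrigin (z - z₀), ?_, fun n => ?_⟩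
  · have h1 : (‖z - z₀‖₊ : ℝ≥0∞) < R := by
      refine lt_trans (ENNReal.coe_lt_coe.2 (hz'.trans ?_)) hR'
      rw [← hrr]; exact lt_add_of_pos_right _ hrpos
    have h2 := hp.changeOrigin h1
    rw [add_sub_cancel] at h2
    refine h2.mono (by exact_mod_cast hrpos) ?_
    refine ENNReal.le_sub_of_add_le_left ENNReal.coe_ne_top ?_
    refine le_trans ?_ hR'.le
    rw [← hrr, ENNReal.coe_add]
    gcongr
  · have h1 : (‖z - z₀‖₊ : ℝ≥0∞) < p.radius :=
      lt_of_lt_of_le (ENNReal.coe_lt_coe.2 hz') (le_trans (by simp) hrad.le)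
    have h2 := p.nnnorm_changeOrigin_le n h1
    have hr' : (r : ℝ≥0∞) < p.radius := lt_of_le_of_lt (by simp) hrad
    have h3 : ∑' s : Σ l : ℕ, { s : Finset (Fin (n + l)) // s.card = l },
        ‖p (n + s.1)‖₊ * ‖z - z₀‖₊ ^ s.1 ≤
        ∑' s : Σ l : ℕ, { s : Finset (Fin (n + l)) // s.card = l }, ‖p (n + s.1)‖₊ * r ^ s.1 := by
      refine Summable.tsum_le_tsum (fun s => ?_) (p.changeOriginSeries_summable_aux₂ h1 n)
        (p.changeOriginSeries_summable_aux₂ hr' n)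
      gcongr
    have h4 : ‖p.changeOrigin (z - z₀) n‖₊ * r ^ n ≤
        ∑' k, ∑' s : Σ l : ℕ, { s : Finset (Fin (k + l)) // s.card = l },
          ‖p (k + s.1)‖₊ * r ^ s.1 * r ^ k := by
      refine le_trans (mul_le_mul_left (h2.trans h3) _) ?_
      rw [← NNReal.tsum_mul_right]
      exact hS.le_tsum n (fun _ _ => zero_le)
    exact_mod_cast h4

/-- On a compact set the Taylor series of an analytic function converge, with uniform bounds, on
balls of a fixed radius. -/
lemma exists_uniform_taylor [CompleteSpace F] {f : H → F} (hf : AnalyticOnNhd ℝ f Set.univ)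
    {K : Set H} (hK : IsCompact K) :
    ∃ r : ℝ, 0 < r ∧ ∃ A : ℝ, ∀ z ∈ K,
      (∀ n, ‖(n.factorial : ℝ)⁻¹ • iteratedFDeriv ℝ n f z‖ * r ^ n ≤ A) ∧
      ∀ h : H, ‖h‖ < r → HasSum
        (fun n => ((n.factorial : ℝ)⁻¹ • iteratedFDeriv ℝ n f z) (fun _ => h)) (f (z + h)) := by
  refine IsCompact.induction_on hK (p := fun K : Set H => ∃ r : ℝ, 0 < r ∧ ∃ A : ℝ, ∀ z ∈ K,
      (∀ n, ‖(n.factorial : ℝ)⁻¹ • iteratedFDeriv ℝ n f z‖ * r ^ n ≤ A) ∧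
      ∀ h : H, ‖h‖ < r → HasSum
        (fun n => ((n.factorial : ℝ)⁻¹ • iteratedFDeriv ℝ n f z) (fun _ => h)) (f (z + h)))
    ?_ ?_ ?_ ?_
  · exact ⟨1, one_pos, 0, by simp⟩
  · rintro s t hst ⟨r, hr, A, h⟩
    exact ⟨r, hr, A, fun z hz => h z (hst hz)⟩
  · rintro s t ⟨r, hr, A, h⟩ ⟨r', hr', A', h'⟩
    refine ⟨min r r', lt_min hr hr', max A A', ?_⟩
    rintro z (hz | hz)
    · refine ⟨fun n => le_trans ?_ (((h z hz).1 n).trans (le_max_left _ _)),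
        fun v hv => (h z hz).2 v (hv.trans_le (min_le_left _ _))⟩
      gcongr; exact min_le_left _ _
    · refine ⟨fun n => le_trans ?_ (((h' z hz).1 n).trans (le_max_right _ _)),
        fun v hv => (h' z hz).2 v (hv.trans_le (min_le_right _ _))⟩
      gcongr; exact min_le_right _ _
  · intro z₀ _
    obtain ⟨r, hr, A, h⟩ := exists_uniform_powerSeries (hf z₀ (Set.mem_univ _))
    refine ⟨_, mem_nhdsWithin_of_mem_nhds h, r, hr, A, ?_⟩
    rintro z ⟨q, hq, hA⟩
    refine ⟨fun n => le_trans ?_ (hA n), fun v hv => ?_⟩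
    · gcongr
      -- `iteratedFDeriv` is the sum of `q n` over the `n!` permutations of its arguments, so
      -- dividing by `n!` does not exceed `‖q n‖`. Taylor coefficients are preferred to a chosen `q`
      -- because they depend continuously on the point, as the integration requires.
      rw [norm_smul, norm_inv, Real.norm_natCast, inv_mul_le_iff₀ (by positivity)]
      refine ContinuousMultilinearMap.opNorm_le_bound (by positivity) fun v => ?_
      rw [hq.iteratedFDeriv_eq_sum_of_completeSpace]
      refine (norm_sum_le _ _).trans ?_
      have : ∀ σ ∈ (Finset.univ : Finset (Equiv.Perm (Fin n))),
          ‖q n (fun i => v (σ i))‖ ≤ ‖q n‖ * ∏ i, ‖v i‖ := fun σ _ => by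
        refine ((q n).le_opNorm _).trans (le_of_eq ?_)
        rw [Equiv.prod_comp σ (fun i => ‖v i‖)]
      refine (Finset.sum_le_card_nsmul _ _ _ this).trans (le_of_eq ?_)
      rw [Finset.card_univ, Fintype.card_perm, Fintype.card_fin, nsmul_eq_mul, mul_assoc]
    · have h1 : v ∈ Metric.eball (0 : H) r := by
        rw [Metric.mem_eball, edist_zero_right, enorm_eq_nnnorm]
        exact_mod_cast hv
      have h2 := hq.hasSum h1
      refine h2.congr_fun ?_
      intro n
      rw [smul_apply, hq.iteratedFDeriv_eq_sum_of_completeSpace,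
        Finset.sum_const, Finset.card_univ, Fintype.card_perm, Fintype.card_fin,
        ← Nat.cast_smul_eq_nsmul ℝ, smul_smul, inv_mul_cancel₀ (by positivity), one_smul]

variable {S : Type*} [TopologicalSpace S] [TopologicalSpace.MetrizableSpace S]
  [MeasurableSpace S] [BorelSpace S] {μ : Measure S} [IsFiniteMeasureOnCompacts μ]

/-- An integral over a compact set of an analytic function, evaluated along a continuous family of
linear maps, is an analytic function. -/
theorem analyticOnNhd_integral_comp [CompleteSpace F] {f : H → F}
    (hf : AnalyticOnNhd ℝ f Set.univ)
    {K : Set S} (hK : IsCompact K) (hKm : MeasurableSet K) {w : S → ℝ} (hw : Continuous w)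
    {L : S → E →L[ℝ] H} (hL : Continuous L) :
    AnalyticOnNhd ℝ (fun e => ∫ s in K, w s • f (L s e) ∂μ) Set.univ := by
  intro e₀ _
  have hcont : ∀ e, Continuous fun s => L s e := fun e => hL.clm_apply continuous_const
  obtain ⟨r, hr, A, hA⟩ := exists_uniform_taylor hf (hK.image (hcont e₀))
  obtain ⟨C₀, hC₀⟩ := hK.exists_bound_of_continuousOn hL.continuousOn
  obtain ⟨W₀, hW₀⟩ := hK.exists_bound_of_continuousOn hw.continuousOn
  -- The summand `1` keeps `C` positive, so that the radius `r / C` makes sense even when all `L s`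
  -- vanish.
  set C := |C₀| + 1 with hC
  have hCpos : 0 < C := by positivity
  have hLC : ∀ s ∈ K, ‖L s‖ ≤ C := fun s hs => by
    linarith [hC₀ s hs, le_abs_self C₀]
  set W := |W₀|
  have hwW : ∀ s ∈ K, ‖w s‖ ≤ W := fun s hs => (hW₀ s hs).trans (le_abs_self _)
  let τ : (n : ℕ) → S → ContinuousMultilinearMap ℝ (fun _ : Fin n => E) F := fun n s =>
    ((n.factorial : ℝ)⁻¹ • iteratedFDeriv ℝ n f (L s e₀)).compContinuousLinearMap (fun _ => L s)
  have hsmooth : ContDiff ℝ ω f :=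
    contDiff_iff_contDiffAt.2 fun x => (hf x (Set.mem_univ _)).contDiffAt
  have hτc : ∀ n, Continuous (τ n) := by
    intro n
    have h0 : Continuous fun s => iteratedFDeriv ℝ n f (L s e₀) :=
      (hsmooth.continuous_iteratedFDeriv (m := n) (by exact_mod_cast le_top)).comp (hcont e₀)
    have h1 : Continuous fun s => (n.factorial : ℝ)⁻¹ • iteratedFDeriv ℝ n f (L s e₀) := by
      exact h0.const_smul ((n.factorial : ℝ)⁻¹)
    have h2 : Continuous fun s =>
        ContinuousMultilinearMap.compContinuousLinearMapContinuousMultilinear ℝ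
          (fun _ : Fin n => E) (fun _ : Fin n => H) F (fun _ => L s) :=
      (ContinuousMultilinearMap.cont _).comp (continuous_pi fun _ => hL)
    exact h2.clm_apply h1
  have hτb : ∀ n, ∀ s ∈ K, ‖τ n s‖ ≤ A * (C / r) ^ n := by
    intro n s hs
    have h1 := (hA _ ⟨s, hs, rfl⟩).1 n
    refine (ContinuousMultilinearMap.norm_compContinuousLinearMap_le _ _).trans ?_
    rw [Finset.prod_const, Finset.card_univ, Fintype.card_fin]
    have h2 : ‖(n.factorial : ℝ)⁻¹ • iteratedFDeriv ℝ n f (L s e₀)‖ ≤ A / r ^ n :=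
      (le_div_iff₀ (by positivity)).2 h1
    calc _ ≤ A / r ^ n * C ^ n := by
          gcongr
          · exact le_trans (norm_nonneg _) h2
          · exact hLC s hs
      _ = _ := by rw [div_pow]; ring
  -- Term-by-term integral of the Taylor series of `e ↦ f (L s e)` at `e₀`. The bound `(C / r) ^ n`
  -- is uniform on `K`, so the radius is at least `r / C` and dominated convergence sums the series.
  let q : FormalMultilinearSeries ℝ E F := fun n => ∫ s in K, w s • τ n s ∂μ
  have hInt : ∀ n, IntegrableOn (fun s => w s • τ n s) K μ := fun n =>
    (hw.smul (hτc n)).continuousOn.integrableOn_compact hK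
  have hμK : μ K ≠ ⊤ := hK.measure_ne_top
  have hρ : 0 < r / C := by positivity
  refine ⟨q, ENNReal.ofReal (r / C), ?_, by simpa using hρ, ?_⟩
  · rw [ENNReal.ofReal]
    refine q.le_radius_of_bound (W * A * μ.real K) fun n => ?_
    have h1 : ‖q n‖ ≤ W * (A * (C / r) ^ n) * μ.real K := by
      refine norm_setIntegral_le_of_norm_le_const hμK.lt_top fun s hs => ?_
      rw [norm_smul]
      exact mul_le_mul (hwW s hs) (hτb n s hs) (norm_nonneg _) (abs_nonneg _)
    rw [Real.coe_toNNReal _ hρ.le]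
    calc ‖q n‖ * (r / C) ^ n ≤ W * (A * (C / r) ^ n) * μ.real K * (r / C) ^ n := by gcongr
      _ = W * A * μ.real K * ((C / r) * (r / C)) ^ n := by rw [mul_pow]; ring
      _ = _ := by
        rw [div_mul_div_cancel₀ hr.ne', div_self hCpos.ne', one_pow, mul_one]
  · intro h hh
    have hh' : ‖h‖ < r / C := by
      rw [Metric.mem_eball, edist_zero_right, ← ofReal_norm] at hh
      exact (ENNReal.ofReal_lt_ofReal_iff hρ).1 hh
    have hq : ∀ n, q n (fun _ => h) =
        ∫ s in K, w s • ((n.factorial : ℝ)⁻¹ • iteratedFDeriv ℝ n f (L s e₀))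
          (fun _ => L s h) ∂μ := by
      intro n
      have := ((ContinuousMultilinearMap.apply ℝ (fun _ : Fin n => E) F
        (fun _ => h)).integral_comp_comm (hInt n)).symm
      exact this
    simp only [hq]
    have hLh : ∀ s ∈ K, ‖L s h‖ ≤ C * ‖h‖ := fun s hs =>
      (L s).le_of_opNorm_le (hLC s hs) h
    have hθ : C * ‖h‖ / r < 1 := by
      rw [div_lt_one hr]
      rwa [lt_div_iff₀ hCpos, mul_comm] at hh'
    have hsum : Summable fun n : ℕ => W * (A * (C * ‖h‖ / r) ^ n) :=
      ((summable_geometric_of_lt_one (by positivity) hθ).mul_left A).mul_left W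
    refine hasSum_integral_of_dominated_convergence
      (fun n _ => W * (A * (C * ‖h‖ / r) ^ n)) (fun n => ?_) (fun n => ?_)
      (Eventually.of_forall fun _ => hsum) ?_ ?_
    · have : Continuous fun s => w s • (τ n s) (fun _ => h) :=
        hw.smul ((ContinuousMultilinearMap.apply ℝ (fun _ : Fin n => E) F
          (fun _ => h)).continuous.comp (hτc n))
      exact this.continuousOn.aestronglyMeasurable_of_isCompact hK hKm
    · refine (ae_restrict_iff' hKm).2 (Eventually.of_forall fun s hs => ?_)
      rw [norm_smul]
      refine mul_le_mul (hwW s hs) ?_ (norm_nonneg _) (abs_nonneg _)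
      refine (ContinuousMultilinearMap.le_opNorm (τ n s) (fun _ => h)).trans ?_
      rw [Finset.prod_const, Finset.card_univ, Fintype.card_fin]
      calc ‖τ n s‖ * ‖h‖ ^ n ≤ A * (C / r) ^ n * ‖h‖ ^ n := by
            gcongr; exact hτb n s hs
        _ = _ := by rw [mul_assoc, ← mul_pow]; congr 2; ring
    · exact integrableOn_const hμK
    · refine (ae_restrict_iff' hKm).2 (Eventually.of_forall fun s hs => ?_)
      have h1 : ‖L s h‖ < r := (hLh s hs).trans_lt ((div_lt_one hr).1 hθ)
      have h2 := (hA _ ⟨s, hs, rfl⟩).2 (L s h) h1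
      rw [← map_add] at h2
      exact h2.const_smul _

/-- Differentiation under the integral sign over a compact set. -/
theorem hasFDerivAt_integral_comp [ProperSpace E] {f : H → F} (hf : ContDiff ℝ 1 f)
    {K : Set S} (hK : IsCompact K) (hKm : MeasurableSet K) {w : S → ℝ} (hw : Continuous w)
    {L : S → E →L[ℝ] H} (hL : Continuous L) (e₀ : E) :
    HasFDerivAt (fun e => ∫ s in K, w s • f (L s e) ∂μ)
      (∫ s in K, w s • (fderiv ℝ f (L s e₀)).comp (L s) ∂μ) e₀ := by
  have hcL : Continuous fun p : E × S => L p.2 p.1 :=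
    (hL.comp continuous_snd).clm_apply continuous_fst
  have hcF' : Continuous fun p : E × S => w p.2 • (fderiv ℝ f (L p.2 p.1)).comp (L p.2) :=
    (hw.comp continuous_snd).smul
      (((hf.continuous_fderiv one_ne_zero).comp hcL).clm_comp (hL.comp continuous_snd))
  have hcF : Continuous fun p : E × S => w p.2 • f (L p.2 p.1) :=
    (hw.comp continuous_snd).smul (hf.continuous.comp hcL)
  obtain ⟨C, hC⟩ := ((isCompact_closedBall e₀ 1).prod hK).exists_bound_of_continuousOn
    hcF'.continuousOn
  refine hasFDerivAt_integral_of_dominated_of_fderiv_le (bound := fun _ => C)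
    (F := fun e s => w s • f (L s e))
    (F' := fun e s => w s • (fderiv ℝ f (L s e)).comp (L s))
    (Metric.closedBall_mem_nhds e₀ one_pos) ?_ ?_ ?_ ?_ ?_ ?_
  · exact Eventually.of_forall fun e =>
      (hcF.comp (Continuous.prodMk_right e)).continuousOn.aestronglyMeasurable_of_isCompact hK hKm
  · exact (hcF.comp (Continuous.prodMk_right e₀)).continuousOn.integrableOn_compact hK
  · exact (hcF'.comp (Continuous.prodMk_right e₀)).continuousOn.aestronglyMeasurable_of_isCompact
      hK hKm
  · exact (ae_restrict_iff' hKm).2 (Eventually.of_forall fun s hs e he => hC (e, s) ⟨he, hs⟩)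
  · exact integrableOn_const hK.measure_ne_top
  · refine Eventually.of_forall fun s e _ => ?_
    exact (((hf.differentiable one_ne_zero) (L s e)).hasFDerivAt.comp e
      (L s).hasFDerivAt).const_smul (w s)

end ParametricAnalytic

/-! ### Calculus of directional derivatives of analytic functions. -/

section DirectionalDerivative

variable {E A : Type*} [NormedAddCommGroup E] [NormedSpace ℝ E]
  [NormedAddCommGroup A] [NormedSpace ℝ A]

/-- The derivative of `f` in the direction `v`. -/
def dd (v : E) (f : E → A) (x : E) : A := fderiv ℝ f x v

/-- Real analyticity on the whole space. -/
abbrev RealAnalytic (f : E → A) : Prop := AnalyticOnNhd ℝ f Set.univ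

lemma pd_eq_dd (j : Fin 3) (f : Space → A) : pd j f = dd (EuclideanSpace.single j (1 : ℝ)) f := rfl

lemma RealAnalytic.contDiff [CompleteSpace A] {f : E → A} (hf : RealAnalytic f)
    {n : WithTop ℕ∞} : ContDiff ℝ n f :=
  contDiff_iff_contDiffAt.2 fun x => (hf x (Set.mem_univ _)).contDiffAt

lemma RealAnalytic.differentiable {f : E → A} (hf : RealAnalytic f) : Differentiable ℝ f :=
  fun x => (hf x (Set.mem_univ _)).differentiableAt

lemma RealAnalytic.dd [CompleteSpace A] {f : E → A} (hf : RealAnalytic f) (v : E) :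
    RealAnalytic (dd v f) := by
  intro x hx
  exact ((ContinuousLinearMap.apply ℝ A v).analyticAt _).comp (hf.fderiv x hx)

lemma RealAnalytic.pd [CompleteSpace A] {f : Space → A} (hf : RealAnalytic f) (j : Fin 3) :
    RealAnalytic (pd j f) := RealAnalytic.dd hf _

lemma dd_comm [CompleteSpace A] {f : E → A} (hf : RealAnalytic f) (v w : E) :
    dd v (dd w f) = dd w (dd v f) := by
  funext x
  have hs : IsSymmSndFDerivAt ℝ f x :=
    (hf.contDiff (n := 2)).contDiffAt.isSymmSndFDerivAt (by simp)
  have hd : DifferentiableAt ℝ (fderiv ℝ f) x :=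
    ((hf.contDiff (n := 2)).fderiv_right (m := 1) (by norm_num)).differentiable one_ne_zero x
  have key : ∀ a b : E, dd a (dd b f) x = fderiv ℝ (fderiv ℝ f) x a b := by
    intro a b
    change fderiv ℝ (fun y => fderiv ℝ f y b) x a = _
    rw [fderiv_clm_apply hd (differentiableAt_const b)]
    simp
  rw [key, key, hs.eq]

lemma dd_add {f g : E → A} (hf : RealAnalytic f) (hg : RealAnalytic g) (v : E) :
    dd v (fun x => f x + g x) = fun x => dd v f x + dd v g x := by
  funext x
  simp [dd, fderiv_fun_add (hf.differentiable x) (hg.differentiable x)]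

lemma dd_sub {f g : E → A} (hf : RealAnalytic f) (hg : RealAnalytic g) (v : E) :
    dd v (fun x => f x - g x) = fun x => dd v f x - dd v g x := by
  funext x
  simp [dd, fderiv_fun_sub (hf.differentiable x) (hg.differentiable x)]

lemma dd_sum {ι : Type*} {s : Finset ι} {f : ι → E → A} (hf : ∀ i, RealAnalytic (f i)) (v : E) :
    dd v (fun x => ∑ i ∈ s, f i x) = fun x => ∑ i ∈ s, dd v (f i) x := by
  funext x
  simp [dd, fderiv_fun_sum (fun i _ => (hf i).differentiable x)]

lemma dd_mul {𝔸 : Type*} [NormedCommRing 𝔸] [NormedAlgebra ℝ 𝔸] {f g : E → 𝔸}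
    (hf : RealAnalytic f) (hg : RealAnalytic g) (v : E) :
    dd v (fun x => f x * g x) = fun x => f x * dd v g x + dd v f x * g x := by
  funext x
  simp [dd, fderiv_fun_mul (hf.differentiable x) (hg.differentiable x), mul_comm (g x)]

end DirectionalDerivative

/-! ### Space-time, its slices, and the Laplacian. -/

/-- Space-time. -/
abbrev ST : Type := ℝ × Space

/-- The unit vector in the time direction. -/
def eT : ST := (1, 0)

/-- The unit vector in the direction of the `i`-th space coordinate. -/
def eX (i : Fin 3) : ST := (0, EuclideanSpace.single i 1)

section Slices

variable {A : Type*} [NormedAddCommGroup A] [NormedSpace ℝ A]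

lemma hasDerivAt_slice {h : ST → A} (hh : RealAnalytic h) (t : ℝ) (x : Space) :
    HasDerivAt (fun s => h (s, x)) (dd eT h (t, x)) t := by
  have h1 : HasDerivAt (fun s : ℝ => ((s, x) : ST)) eT t :=
    (hasDerivAt_id t).prodMk (hasDerivAt_const t x)
  exact (hh.differentiable (t, x)).hasFDerivAt.comp_hasDerivAt t h1

lemma hasFDerivAt_slice {h : ST → A} (hh : RealAnalytic h) (t : ℝ) (x : Space) :
    HasFDerivAt (fun y => h (t, y)) ((fderiv ℝ h (t, x)).comp (ContinuousLinearMap.inr ℝ ℝ Space))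
      x :=
  (hh.differentiable (t, x)).hasFDerivAt.comp x (hasFDerivAt_prodMk_right t x)

lemma pd_slice {h : ST → A} (hh : RealAnalytic h) (t : ℝ) (i : Fin 3) :
    pd i (fun y => h (t, y)) = fun x => dd (eX i) h (t, x) := by
  funext x
  rw [pd, (hasFDerivAt_slice hh t x).fderiv]
  rfl

end Slices

/-- The Laplacian. -/
def lap (f : Space → ℝ) (x : Space) : ℝ := ∑ i, pd i (pd i f) x

lemma RealAnalytic.lap {f : Space → ℝ} (hf : RealAnalytic f) : RealAnalytic (lap f) := by
  have : NullLight.lap f = fun x => ∑ i, NullLight.pd i (NullLight.pd i f) x := rfl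
  rw [this]
  exact Finset.analyticOnNhd_fun_sum _ fun i _ => (hf.pd i).pd i

lemma pd_lap {f : Space → ℝ} (hf : RealAnalytic f) (i : Fin 3) : pd i (lap f) = lap (pd i f) := by
  have : lap f = fun x => ∑ i, pd i (pd i f) x := rfl
  rw [this, pd_eq_dd, dd_sum fun j => (hf.pd j).pd j]
  funext x
  refine Finset.sum_congr rfl fun j _ => ?_
  simp only [pd_eq_dd]
  rw [dd_comm (hf.dd _), dd_comm hf (EuclideanSpace.single i 1)]

/-! ### Weighted means over the unit ball. -/

section BallMean

/-- The linear map `(t, x) ↦ x + t y`. -/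
def shift (y : Space) : ST →L[ℝ] Space :=
  ContinuousLinearMap.snd ℝ ℝ Space + (ContinuousLinearMap.fst ℝ ℝ Space).smulRight y

lemma shift_apply (y : Space) (p : ST) : shift y p = p.2 + p.1 • y := by simp [shift]

lemma continuous_shift : Continuous shift := by
  have h : Continuous fun y : Space =>
      ContinuousLinearMap.smulRightL ℝ ST Space (ContinuousLinearMap.fst ℝ ℝ Space) y :=
    ContinuousLinearMap.continuous _
  exact continuous_const.add h

/-- The weighted mean `∫ w(y) f(x + t y) dy` over the unit ball. -/
def ballMean (w : Space → ℝ) (f : Space → ℝ) (p : ST) : ℝ :=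
  ∫ y in Metric.closedBall (0 : Space) 1, w y • f (shift y p)

variable {w f : Space → ℝ}

lemma integrableOn_ballMean (hw : Continuous w) (hf : Continuous f) (p : ST) :
    IntegrableOn (fun y => w y • f (shift y p)) (Metric.closedBall (0 : Space) 1) := by
  exact (hw.smul (hf.comp (continuous_shift.clm_apply continuous_const))).continuousOn
    |>.integrableOn_compact
    (isCompact_closedBall _ _)

lemma RealAnalytic.ballMean (hw : Continuous w) (hf : RealAnalytic f) :
    RealAnalytic (ballMean w f) :=
  analyticOnNhd_integral_comp hf (isCompact_closedBall _ _) Metric.isClosed_closedBall.measurableSet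
    hw continuous_shift

lemma dd_ballMean (hw : Continuous w) (hf : RealAnalytic f) (v p : ST) :
    dd v (ballMean w f) p =
      ∫ y in Metric.closedBall (0 : Space) 1, w y • fderiv ℝ f (shift y p) (v.2 + v.1 • y) := by
  have h := hasFDerivAt_integral_comp (μ := volume) (hf.contDiff (n := 1))
    (isCompact_closedBall (0 : Space) 1)
    Metric.isClosed_closedBall.measurableSet hw continuous_shift p
  have h2 : Continuous fun y : Space => w y • (fderiv ℝ f (shift y p)).comp (shift y) :=
    hw.smul ((((hf.contDiff (n := 1)).continuous_fderiv one_ne_zero).comp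
      (continuous_shift.clm_apply continuous_const)).clm_comp continuous_shift)
  have h3 : IntegrableOn (fun y : Space => w y • (fderiv ℝ f (shift y p)).comp (shift y))
      (Metric.closedBall (0 : Space) 1) :=
    h2.continuousOn.integrableOn_compact (isCompact_closedBall _ _)
  change fderiv ℝ (ballMean w f) p v = _
  have h' : fderiv ℝ (ballMean w f) p = _ := h.fderiv
  rw [h', ContinuousLinearMap.integral_apply h3]
  refine integral_congr_ae (Eventually.of_forall fun y => ?_)
  simp [shift_apply]

lemma dd_eX_ballMean (hw : Continuous w) (hf : RealAnalytic f) (i : Fin 3) :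
    dd (eX i) (ballMean w f) = ballMean w (pd i f) := by
  funext p
  rw [dd_ballMean hw hf]
  simp [ballMean, eX, pd]

lemma fderiv_apply_eq_sum (f : Space → ℝ) (x y : Space) :
    fderiv ℝ f x y = ∑ i, y i * pd i f x := by
  have hy : y = ∑ i, y i • EuclideanSpace.single i (1 : ℝ) := by
    ext j
    simp [Pi.single_apply]
  conv_lhs => rw [hy, map_sum]
  simp [pd]

lemma ballMean_sum_right (hw : Continuous w) {g : Fin 3 → Space → ℝ} (hg : ∀ i, Continuous (g i))
    (p : ST) : ballMean w (fun x => ∑ i, g i x) p = ∑ i, ballMean w (g i) p := by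
  simp only [ballMean]
  rw [← integral_finsetSum _ fun i _ => integrableOn_ballMean hw (hg i) p]
  simp only [Finset.smul_sum]

lemma dd_eT_ballMean (hw : Continuous w) (hf : RealAnalytic f) (p : ST) :
    dd eT (ballMean w f) p = ∑ i, ballMean (fun y => w y * y i) (pd i f) p := by
  rw [dd_ballMean hw hf]
  simp only [ballMean]
  rw [← integral_finsetSum]
  · refine integral_congr_ae (Eventually.of_forall fun y => ?_)
    simp only [eT, one_smul, zero_add, fderiv_apply_eq_sum f, smul_eq_mul, Finset.mul_sum]
    exact Finset.sum_congr rfl fun i _ => by ring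
  · intro i _
    have hc : Continuous fun y : Space => w y * y i := by fun_prop
    exact integrableOn_ballMean hc ((hf.pd i).contDiff (n := 0)).continuous p

/-- Integration by parts in the ball mean. -/
lemma mul_ballMean_pd {P : Space → ℝ} (hP : Differentiable ℝ P) {i : Fin 3}
    (hP' : Continuous (pd i P)) (hP0 : ∀ y ∉ Metric.closedBall (0 : Space) 1, P y = 0)
    (hP'0 : ∀ y ∉ Metric.closedBall (0 : Space) 1, pd i P y = 0) (hf : RealAnalytic f) (p : ST) :
    p.1 * ballMean P (pd i f) p = - ballMean (pd i P) f p := by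
  have hK := isCompact_closedBall (0 : Space) 1
  -- The chain rule in `y` produces the factor `t = p.1`. Both `P` and its derivative vanish off the
  -- ball, so the integrals extend to the whole space and no boundary term appears.
  let g : Space → ℝ := fun y => f (shift y p)
  have hg : ∀ y, HasFDerivAt g (p.1 • fderiv ℝ f (shift y p)) y := by
    intro y
    have h1 : HasFDerivAt (fun y : Space => shift y p)
        (p.1 • ContinuousLinearMap.id ℝ Space) y := by
      simp only [shift_apply]
      exact ((hasFDerivAt_id y).const_smul p.1).const_add p.2
    have h2 := (hf.differentiable (shift y p)).hasFDerivAt.comp y h1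
    have h3 : (fderiv ℝ f (shift y p)).comp (p.1 • ContinuousLinearMap.id ℝ Space) =
        p.1 • fderiv ℝ f (shift y p) := by
      ext v; simp
    rw [h3] at h2
    exact h2
  have hgc : Continuous g := (hf.contDiff (n := 0)).continuous.comp
    (continuous_shift.clm_apply continuous_const)
  have hg' : (fun y => fderiv ℝ g y (EuclideanSpace.single i 1)) =
      fun y => p.1 * pd i f (shift y p) := by
    funext y; rw [(hg y).fderiv]; simp [pd]
  have hg'c : Continuous (fun y => fderiv ℝ g y (EuclideanSpace.single i 1)) := by
    rw [hg']
    exact continuous_const.mul (((hf.pd i).contDiff (n := 0)).continuous.comp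
      (continuous_shift.clm_apply continuous_const))
  have ibp := integral_mul_fderiv_eq_neg_fderiv_mul_of_integrable (μ := (volume : Measure Space))
    (f := P) (g := g) (v := EuclideanSpace.single i 1)
    ((hP'.mul hgc).integrable_of_hasCompactSupport
      (HasCompactSupport.intro hK fun y hy => by
        simp only [Pi.mul_apply]; rw [hP'0 y hy, zero_mul]))
    ((hP.continuous.mul hg'c).integrable_of_hasCompactSupport
      (HasCompactSupport.intro hK fun y hy => by
        simp only [Pi.mul_apply]; rw [hP0 y hy, zero_mul]))
    ((hP.continuous.mul hgc).integrable_of_hasCompactSupport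
      (HasCompactSupport.intro hK fun y hy => by
        simp only [Pi.mul_apply]; rw [hP0 y hy, zero_mul]))
    (fun x _ => hP x) (fun x _ => (hg x).differentiableAt)
  have e1 : p.1 * ballMean P (pd i f) p =
      ∫ y, P y * fderiv ℝ g y (EuclideanSpace.single i 1) := by
    rw [← setIntegral_eq_integral_of_forall_compl_eq_zero (s := Metric.closedBall (0 : Space) 1)
      (fun y hy => by rw [hP0 y hy, zero_mul]), ballMean, ← integral_const_mul]
    refine integral_congr_ae (Eventually.of_forall fun y => ?_)
    simp only [congrFun hg' y, smul_eq_mul]; ring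
  have e2 : ballMean (pd i P) f p = ∫ y, fderiv ℝ P y (EuclideanSpace.single i 1) * g y := by
    rw [← setIntegral_eq_integral_of_forall_compl_eq_zero (s := Metric.closedBall (0 : Space) 1)
      (fun y hy => by
        have := hP'0 y hy
        simp only [pd] at this
        rw [this, zero_mul]), ballMean]
    rfl
  rw [e1, e2, ibp]

end BallMean

/-- Squaring the positive part removes its kink at `0`. This makes the averaging weight `wt ^ 2` and
the light-cone weight `cone R ^ 2` differentiable across their boundaries, as integration by parts
demands. -/
lemma hasDerivAt_max_zero_sq (s : ℝ) :
    HasDerivAt (fun s : ℝ => (max 0 s) ^ 2) (2 * max 0 s) s := by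
  rcases lt_trichotomy s 0 with h | h | h
  · rw [max_eq_left h.le, mul_zero]
    refine (hasDerivAt_const s (0 : ℝ)).congr_of_eventuallyEq ?_
    filter_upwards [eventually_lt_nhds h] with u hu
    simp [max_eq_left hu.le]
  · subst h
    rw [max_self, mul_zero, hasDerivAt_iff_isLittleO_nhds_zero]
    have h1 : (fun u : ℝ => u ^ 2) =o[𝓝 0] fun u : ℝ => u := by
      simpa using Asymptotics.isLittleO_pow_id (𝕜 := ℝ) one_lt_two
    refine (Asymptotics.IsBigO.of_bound 1 (Eventually.of_forall fun u => ?_)).trans_isLittleO h1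
    simp only [zero_add, max_self, smul_zero, sub_zero, norm_pow, Real.norm_eq_abs, one_mul]
    simp only [ne_eq, OfNat.ofNat_ne_zero, not_false_eq_true, zero_pow, sub_zero, abs_pow]
    refine pow_le_pow_left₀ (abs_nonneg _) ?_ 2
    rcases le_total u 0 with hu | hu
    · simp [max_eq_left hu]
    · simp [max_eq_right hu]
  · rw [max_eq_right h.le]
    have h1 : HasDerivAt (fun u : ℝ => u ^ 2) (2 * s) s := by simpa using hasDerivAt_pow 2 s
    refine h1.congr_of_eventuallyEq ?_
    filter_upwards [eventually_gt_nhds h] with u hu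
    simp [max_eq_right hu.le]

/-! ### The wave equation solved by weighted ball means. -/

section Weights

/-- The weight `(1 - |y|²)₊`. -/
def wt (y : Space) : ℝ := max 0 (1 - ‖y‖ ^ 2)

lemma continuous_wt : Continuous wt := by unfold wt; fun_prop

lemma continuous_wt_sq : Continuous fun y => wt y ^ 2 := continuous_wt.pow 2

lemma wt_eq_zero {y : Space} (hy : y ∉ Metric.closedBall (0 : Space) 1) : wt y = 0 := by
  have h : 1 < ‖y‖ := by simpa using hy
  exact max_eq_left (by nlinarith)

lemma norm_sq_mul_wt (y : Space) : ‖y‖ ^ 2 * wt y = wt y - wt y ^ 2 := by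
  unfold wt
  rcases le_total (1 - ‖y‖ ^ 2) 0 with h | h
  · simp [max_eq_left h]
  · rw [max_eq_right h]; ring

lemma hasFDerivAt_wt_sq (y : Space) :
    HasFDerivAt (fun y => wt y ^ 2) ((-4 * wt y) • innerSL ℝ y) y := by
  have h1 : HasFDerivAt (fun y : Space => 1 - ‖y‖ ^ 2) (-(2 • innerSL ℝ y)) y :=
    ((hasStrictFDerivAt_norm_sq y).hasFDerivAt).const_sub 1
  have h2 := (hasDerivAt_max_zero_sq (1 - ‖y‖ ^ 2)).comp_hasFDerivAt y h1
  have h3 : (2 * max 0 (1 - ‖y‖ ^ 2)) • (-(2 • innerSL ℝ y)) = (-4 * wt y) • innerSL ℝ y := by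
    ext v; simp [wt]; ring
  rw [h3] at h2
  exact h2

lemma differentiable_wt_sq : Differentiable ℝ fun y => wt y ^ 2 :=
  fun y => (hasFDerivAt_wt_sq y).differentiableAt

lemma pd_wt_sq (i : Fin 3) : pd i (fun y => wt y ^ 2) = fun y => -4 * (wt y * y i) := by
  funext y
  rw [pd, (hasFDerivAt_wt_sq y).fderiv]
  simp [EuclideanSpace.inner_single_right]
  ring

lemma pd_wt_sq_mul (i : Fin 3) :
    pd i (fun y => wt y ^ 2 * y i) = fun y => wt y ^ 2 - 4 * (wt y * y i ^ 2) := by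
  funext y
  have h1 : HasFDerivAt (fun y : Space => y i) (EuclideanSpace.proj i : Space →L[ℝ] ℝ) y :=
    (EuclideanSpace.proj i : Space →L[ℝ] ℝ).hasFDerivAt
  rw [pd, ((hasFDerivAt_wt_sq y).fun_mul h1).fderiv]
  simp [EuclideanSpace.inner_single_right]
  ring

variable {f : Space → ℝ}

lemma ballMean_const_mul (c : ℝ) (w f : Space → ℝ) (p : ST) :
    ballMean (fun y => c * w y) f p = c * ballMean w f p := by
  simp only [ballMean]
  rw [← integral_const_mul]
  simp [mul_assoc]

/-- Differentiation in `t` brings out the weight `wt y · yᵢ`, which is `-1/4` of `∂ᵢ(wt²)`;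
integration by parts then moves the derivative onto `∂ᵢ f`. -/
lemma dd_eT_ballMean_wt (hf : RealAnalytic f) (p : ST) :
    dd eT (ballMean wt f) p = p.1 / 4 * ballMean (fun y => wt y ^ 2) (lap f) p := by
  rw [dd_eT_ballMean continuous_wt hf]
  have h1 : ballMean (fun y => wt y ^ 2) (lap f) p =
      ∑ i, ballMean (fun y => wt y ^ 2) (pd i (pd i f)) p :=
    ballMean_sum_right continuous_wt_sq
      (fun i => (((hf.pd i).pd i).contDiff (n := 0)).continuous) p
  rw [h1, Finset.mul_sum]
  refine Finset.sum_congr rfl fun i _ => ?_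
  have h2 := mul_ballMean_pd (i := i) differentiable_wt_sq
    (by rw [pd_wt_sq]; exact continuous_const.mul (continuous_wt.mul (by fun_prop)))
    (fun y hy => by simp [wt_eq_zero hy])
    (fun y hy => by rw [pd_wt_sq]; simp [wt_eq_zero hy]) (hf.pd i) p
  rw [pd_wt_sq, ballMean_const_mul] at h2
  linarith

/-- Integration by parts against `div (wt² y) = 3 wt² - 4 wt |y|² = 7 wt² - 4 wt`, the last step by
`|y|² wt = wt - wt²`. With `dd_eT_ballMean_wt` this closes the system: time derivatives of the two
means are again expressed by such means. -/
lemma mul_dd_eT_ballMean_wt_sq (hf : RealAnalytic f) (p : ST) :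
    p.1 * dd eT (ballMean (fun y => wt y ^ 2) f) p =
      4 * ballMean wt f p - 7 * ballMean (fun y => wt y ^ 2) f p := by
  have hfc : Continuous f := (hf.contDiff (n := 0)).continuous
  have hc : ∀ i, Continuous fun y : Space => wt y ^ 2 - 4 * (wt y * y i ^ 2) := fun i =>
    continuous_wt_sq.sub (continuous_const.mul (continuous_wt.mul (by fun_prop)))
  rw [dd_eT_ballMean continuous_wt_sq hf, Finset.mul_sum]
  have h2 : ∀ i, p.1 * ballMean (fun y => wt y ^ 2 * y i) (pd i f) p =
      -ballMean (fun y => wt y ^ 2 - 4 * (wt y * y i ^ 2)) f p := by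
    intro i
    rw [mul_ballMean_pd (i := i) ?_ ?_ ?_ ?_ hf p, pd_wt_sq_mul]
    · exact differentiable_wt_sq.mul (EuclideanSpace.proj i : Space →L[ℝ] ℝ).differentiable
    · rw [pd_wt_sq_mul]; exact hc i
    · intro y hy; simp [wt_eq_zero hy]
    · intro y hy; rw [pd_wt_sq_mul]; simp [wt_eq_zero hy]
  simp only [h2, Finset.sum_neg_distrib]
  simp only [ballMean]
  rw [← integral_finsetSum _ fun i _ => integrableOn_ballMean (hc i) hfc p, ← integral_neg,
    ← integral_const_mul, ← integral_const_mul, ← integral_sub]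
  · refine integral_congr_ae (Eventually.of_forall fun y => ?_)
    simp only [smul_eq_mul]
    have h3 := norm_sq_mul_wt y
    rw [EuclideanSpace.norm_sq_eq] at h3
    simp only [Fin.sum_univ_three, Real.norm_eq_abs, sq_abs] at h3 ⊢
    linear_combination (4 * f (shift y p)) * h3
  · exact (integrableOn_ballMean continuous_wt hfc p).const_mul 4
  · exact (integrableOn_ballMean continuous_wt_sq hfc p).const_mul 7

/-- The total mass of the weight. -/
def wtMass : ℝ := ∫ y in Metric.closedBall (0 : Space) 1, wt y

lemma wtMass_pos : 0 < wtMass := by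
  have hK := isCompact_closedBall (0 : Space) 1
  have e : wtMass = ∫ y, wt y :=
    setIntegral_eq_integral_of_forall_compl_eq_zero fun y hy => wt_eq_zero hy
  rw [e]
  refine continuous_wt.integral_pos_of_hasCompactSupport_nonneg_nonzero
    (HasCompactSupport.intro hK fun y hy => wt_eq_zero hy) (fun y => le_max_left _ _) (x := 0) ?_
  simp [wt]

/-- The solution of the wave equation with initial data `(0, f)`. -/
def wave (f : Space → ℝ) (p : ST) : ℝ :=
  -- This is Kirchhoff's `t` times the spherical mean. Divided by `wtMass`, the means with weights
  -- `wt` and `wt²` multiply the term `t^(2j) Δ^j f / (2j+1)!` of the spherical mean by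
  -- `15/((2j+3)(2j+5))` and `60/((2j+3)(2j+5)(2j+7))`; the constants `1/20` and `1/15` bring the
  -- total coefficient of `t^(2j+1) Δ^j f` back to `1/(2j+1)!`.
  wtMass⁻¹ * (p.1 * (ballMean wt f p + p.1 ^ 2 / 20 * ballMean (fun y => wt y ^ 2) (lap f) p
    + p.1 ^ 2 / 15 * ballMean wt (lap f) p))

lemma realAnalytic_fst : RealAnalytic (fun p : ST => p.1) :=
  fun p _ => (ContinuousLinearMap.fst ℝ ℝ Space).analyticAt p

lemma realAnalytic_wave (hf : RealAnalytic f) : RealAnalytic (wave f) := by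
  have h1 : RealAnalytic (ballMean wt f) := hf.ballMean continuous_wt
  have h2 : RealAnalytic (ballMean wt (lap f)) := hf.lap.ballMean continuous_wt
  have h3 : RealAnalytic (ballMean (fun y => wt y ^ 2) (lap f)) :=
    hf.lap.ballMean continuous_wt_sq
  intro p hp
  have ht := realAnalytic_fst p hp
  exact analyticAt_const.mul (ht.mul (((h1 p hp).add
    (((ht.pow 2).div_const).mul (h3 p hp))).add (((ht.pow 2).div_const).mul (h2 p hp))))

lemma dd_eT_eq {A : Type*} [NormedAddCommGroup A] [NormedSpace ℝ A] {h : ST → A}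
    (hh : RealAnalytic h) {p : ST} {d : A} (hd : HasDerivAt (fun s => h (s, p.2)) d p.1) :
    dd eT h p = d :=
  (hasDerivAt_slice hh p.1 p.2).unique hd

lemma dd_eT_wave (hf : RealAnalytic f) : dd eT (wave f) = fun p => wtMass⁻¹ *
    (ballMean wt f p + p.1 ^ 2 / 20 * ballMean (fun y => wt y ^ 2) (lap f) p
      + 2 * p.1 ^ 2 / 5 * ballMean wt (lap f) p
      + p.1 ^ 4 / 60 * ballMean (fun y => wt y ^ 2) (lap (lap f)) p) := by
  funext p
  refine dd_eT_eq (realAnalytic_wave hf) ?_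
  have h1 := hasDerivAt_slice (hf.ballMean continuous_wt) p.1 p.2
  have h2 := hasDerivAt_slice (hf.lap.ballMean continuous_wt) p.1 p.2
  have h3 := hasDerivAt_slice (hf.lap.ballMean continuous_wt_sq) p.1 p.2
  rw [dd_eT_ballMean_wt hf] at h1
  rw [dd_eT_ballMean_wt hf.lap] at h2
  have h4 := mul_dd_eT_ballMean_wt_sq hf.lap p
  have hid := hasDerivAt_id' p.1
  have := ((hid.mul ((h1.add (((hid.pow 2).div_const 20).mul h3)).add
    (((hid.pow 2).div_const 15).mul h2)))).const_mul wtMass⁻¹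
  refine this.congr_deriv ?_
  simp only [Pi.add_apply, Pi.mul_apply, Pi.pow_apply]
  -- The derivative of the `wt²` mean is known only after multiplication by `t`; it occurs here with
  -- the factor `t ^ 3`, so no division by `t` is needed.
  linear_combination wtMass⁻¹ * p.1 ^ 2 / 20 * h4

/-- `wave f` solves the wave equation. -/
lemma dd_eT_dd_eT_wave (hf : RealAnalytic f) : dd eT (dd eT (wave f)) = wave (lap f) := by
  funext p
  refine dd_eT_eq ((realAnalytic_wave hf).dd eT) ?_
  rw [dd_eT_wave hf]
  have h1 := hasDerivAt_slice (hf.ballMean continuous_wt) p.1 p.2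
  have h2 := hasDerivAt_slice (hf.lap.ballMean continuous_wt) p.1 p.2
  have h3 := hasDerivAt_slice (hf.lap.ballMean continuous_wt_sq) p.1 p.2
  have h4 := hasDerivAt_slice (hf.lap.lap.ballMean continuous_wt_sq) p.1 p.2
  rw [dd_eT_ballMean_wt hf] at h1
  rw [dd_eT_ballMean_wt hf.lap] at h2
  have h5 := mul_dd_eT_ballMean_wt_sq hf.lap p
  have h6 := mul_dd_eT_ballMean_wt_sq hf.lap.lap p
  have hid := hasDerivAt_id' p.1
  have := (((h1.add (((hid.pow 2).div_const 20).mul h3)).add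
    ((((hid.pow 2).const_mul 2).div_const 5).mul h2)).add
    (((hid.pow 4).div_const 60).mul h4)).const_mul wtMass⁻¹
  refine this.congr_deriv ?_
  simp only [Pi.pow_apply, wave]
  linear_combination wtMass⁻¹ * p.1 / 20 * h5 + wtMass⁻¹ * p.1 ^ 3 / 60 * h6

lemma wave_zero_left (x : Space) : wave f (0, x) = 0 := by simp [wave]

lemma dd_eT_wave_zero_left (hf : RealAnalytic f) (x : Space) : dd eT (wave f) (0, x) = f x := by
  rw [dd_eT_wave hf]
  have : ballMean wt f (0, x) = wtMass * f x := by
    simp only [ballMean, shift_apply, zero_smul, add_zero, smul_eq_mul, wtMass]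
    rw [integral_mul_const]
  simp only [this]
  have := wtMass_pos.ne'
  field_simp
  ring

/-- Powers of `t` are constant along space directions, so each summand of `wave` can be
differentiated separately. -/
lemma hasDerivAt_mul_line {p : ST} (i : Fin 3) (g : ℝ → ℝ) {h : ST → ℝ} (hh : RealAnalytic h) :
    HasDerivAt (fun s : ℝ => g (p + s • eX i).1 * h (p + s • eX i)) (g p.1 * dd (eX i) h p) 0 := by
  have e : ∀ s : ℝ, (p + s • eX i).1 = p.1 := fun s => by simp [eX]
  simp only [e]
  refine HasDerivAt.const_mul _ ?_
  have h1 : HasDerivAt (fun s : ℝ => p + s • eX i) (eX i) 0 := by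
    simpa using ((hasDerivAt_id (0 : ℝ)).smul_const (eX i)).const_add p
  have h2 : HasFDerivAt h (fderiv ℝ h p) (p + (0 : ℝ) • eX i) := by
    simpa using (hh.differentiable p).hasFDerivAt
  exact h2.comp_hasDerivAt 0 h1

lemma dd_eX_wave (hf : RealAnalytic f) (i : Fin 3) : dd (eX i) (wave f) = wave (pd i f) := by
  funext p
  have h1 := hasDerivAt_mul_line (p := p) i (fun t => wtMass⁻¹ * t) (hf.ballMean continuous_wt)
  have h2 := hasDerivAt_mul_line (p := p) i (fun t => wtMass⁻¹ * t ^ 3 / 15)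
    (hf.lap.ballMean continuous_wt)
  have h3 := hasDerivAt_mul_line (p := p) i (fun t => wtMass⁻¹ * t ^ 3 / 20)
    (hf.lap.ballMean continuous_wt_sq)
  have h4 := hasDerivAt_mul_line (p := p) i (fun _ => 1) (realAnalytic_wave hf)
  have h5 := (h1.add h2).add h3
  simp only [one_mul] at h4
  rw [h4.unique (h5.congr_of_eventuallyEq (Eventually.of_forall fun s => ?_))]
  · rw [dd_eX_ballMean continuous_wt hf, dd_eX_ballMean continuous_wt hf.lap,
      dd_eX_ballMean continuous_wt_sq hf.lap, pd_lap hf]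
    simp only [wave]
    ring
  · simp only [wave, Pi.add_apply]
    ring

lemma wave_sum {g : Fin 3 → Space → ℝ} (hg : ∀ i, RealAnalytic (g i)) (p : ST) :
    wave (fun x => ∑ i, g i x) p = ∑ i, wave (g i) p := by
  have hl : lap (fun x => ∑ i, g i x) = fun x => ∑ i, lap (g i) x := by
    funext x
    simp only [lap]
    rw [Finset.sum_comm]
    refine Finset.sum_congr rfl fun j _ => ?_
    simp only [pd_eq_dd]
    rw [dd_sum hg, dd_sum fun i => (hg i).dd _]
  have hc : ∀ i, Continuous (g i) := fun i => ((hg i).contDiff (n := 0)).continuous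
  have hc' : ∀ i, Continuous (lap (g i)) := fun i => ((hg i).lap.contDiff (n := 0)).continuous
  simp only [wave, hl]
  rw [ballMean_sum_right continuous_wt hc, ballMean_sum_right continuous_wt hc',
    ballMean_sum_right continuous_wt_sq hc']
  simp only [Fin.sum_univ_three]
  ring

end Weights

/-! ### The curl in cyclic coordinates. -/

section Curl

variable {A : Type*} [NormedAddCommGroup A] [NormedSpace ℝ A]

/-- With indices `i, i + 1, i + 2` modulo 3, curls and cross products have one formula for all
components, which avoids splitting into three cases. -/
lemma sum_cyclic {M : Type*} [AddCommMonoid M] (f : Fin 3 → M) (i : Fin 3) :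
    ∑ j, f j = f i + f (i + 1) + f (i + 2) := by
  fin_cases i <;> simp [Fin.sum_univ_three] <;> abel

lemma add_two_add_one (i : Fin 3) : i + 2 + 1 = i := by fin_cases i <;> rfl
lemma add_two_add_two (i : Fin 3) : i + 2 + 2 = i + 1 := by fin_cases i <;> rfl
lemma add_one_add_one (i : Fin 3) : i + 1 + 1 = i + 2 := by fin_cases i <;> rfl
lemma add_one_add_two (i : Fin 3) : i + 1 + 2 = i := by fin_cases i <;> rfl

lemma curl_apply (f : Space → Fin 3 → A) (x : Space) (i : Fin 3) :
    curl f x i = pd (i + 1) (fun y => f y (i + 2)) x - pd (i + 2) (fun y => f y (i + 1)) x := by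
  fin_cases i <;> rfl

/-- The curl in the space variables of a field on space-time, given by its components. -/
def stCurl (f : Fin 3 → ST → A) (i : Fin 3) (p : ST) : A :=
  dd (eX (i + 1)) (f (i + 2)) p - dd (eX (i + 2)) (f (i + 1)) p

lemma RealAnalytic.stCurl [CompleteSpace A] {f : Fin 3 → ST → A} (hf : ∀ i, RealAnalytic (f i))
    (i : Fin 3) : RealAnalytic (stCurl f i) := fun p hp =>
  ((hf (i + 2)).dd (eX (i + 1)) p hp).sub ((hf (i + 1)).dd (eX (i + 2)) p hp)

lemma dd_stCurl [CompleteSpace A] {f : Fin 3 → ST → A} (hf : ∀ i, RealAnalytic (f i)) (v : ST)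
    (i : Fin 3) (p : ST) : dd v (stCurl f i) p =
      dd v (dd (eX (i + 1)) (f (i + 2))) p - dd v (dd (eX (i + 2)) (f (i + 1))) p :=
  congrFun (dd_sub ((hf (i + 2)).dd (eX (i + 1))) ((hf (i + 1)).dd (eX (i + 2))) v) p

lemma curl_slice {f : Fin 3 → ST → A} (hf : ∀ i, RealAnalytic (f i)) (t : ℝ) (x : Space) :
    curl (fun y i => f i (t, y)) x = fun i => stCurl f i (t, x) := by
  funext i
  rw [curl_apply, pd_slice (hf _), pd_slice (hf _)]
  rfl

lemma div_slice {f : Fin 3 → ST → A} (hf : ∀ i, RealAnalytic (f i)) (t : ℝ) (x : Space) :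
    div (fun y i => f i (t, y)) x = ∑ i, dd (eX i) (f i) (t, x) := by
  simp only [div, pd_slice (hf _)]

/-- The identity `∇ × ∇ × = ∇ (∇ ·) - Δ`, whose first term drops out for a divergence-free field. -/
lemma stCurl_stCurl [CompleteSpace A] {f : Fin 3 → ST → A} (hf : ∀ i, RealAnalytic (f i))
    (hdiv : (fun p => ∑ i, dd (eX i) (f i) p) = 0) (i : Fin 3) (p : ST) :
    stCurl (stCurl f) i p = - ∑ j, dd (eX j) (dd (eX j) (f i)) p := by
  have hd : ∑ j, dd (eX i) (dd (eX j) (f j)) p = 0 := by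
    have h1 := congrFun (dd_sum (s := Finset.univ) (fun j => (hf j).dd (eX j)) (eX i)) p
    rw [hdiv] at h1
    rw [← h1]
    change fderiv ℝ (0 : ST → A) p _ = 0
    simp
  rw [stCurl, dd_stCurl hf, dd_stCurl hf, add_two_add_one, add_two_add_two, add_one_add_one,
    add_one_add_two, sum_cyclic _ i]
  rw [sum_cyclic _ i] at hd
  rw [dd_comm (hf (i + 1)) (eX i), dd_comm (hf (i + 2)) (eX i)] at hd
  rw [eq_neg_iff_add_eq_zero, ← hd]
  abel

end Curl

/-- A real analytic solution of Maxwell's equations on all of space-time, by components. -/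
structure AnalyticMaxwell (e b : Fin 3 → ST → ℝ) : Prop where
  analytic_e : ∀ i, RealAnalytic (e i)
  analytic_b : ∀ i, RealAnalytic (b i)
  div_e : ∀ p, ∑ i, dd (eX i) (e i) p = 0
  div_b : ∀ p, ∑ i, dd (eX i) (b i) p = 0
  ampere : ∀ i p, dd eT (e i) p = stCurl b i p
  faraday : ∀ i p, dd eT (b i) p = - stCurl e i p

lemma AnalyticMaxwell.isMaxwellSolution {e b : Fin 3 → ST → ℝ} (h : AnalyticMaxwell e b)
    (r : WithTop ℕ∞) {J : Set ℝ} (hJ : UniqueDiffOn ℝ J) :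
    IsMaxwellSolution r J (fun t x i => e i (t, x)) (fun t x i => b i (t, x)) where
  contDiffOn_E := (contDiff_pi.2 fun i => (h.analytic_e i).contDiff).contDiffOn
  contDiffOn_B := (contDiff_pi.2 fun i => (h.analytic_b i).contDiff).contDiffOn
  div_E t _ x := by rw [div_slice h.analytic_e, h.div_e]
  div_B t _ x := by rw [div_slice h.analytic_b, h.div_b]
  ampere t ht x := by
    rw [curl_slice h.analytic_b]
    refine HasDerivWithinAt.derivWithin (HasDerivAt.hasDerivWithinAt ?_) (hJ t ht)
    refine hasDerivAt_pi.2 fun i => ?_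
    rw [← h.ampere]
    exact hasDerivAt_slice (h.analytic_e i) t x
  faraday t ht x := by
    rw [curl_slice h.analytic_e]
    refine HasDerivWithinAt.derivWithin (HasDerivAt.hasDerivWithinAt ?_) (hJ t ht)
    refine hasDerivAt_pi.2 fun i => ?_
    rw [Pi.neg_apply, ← h.faraday]
    exact hasDerivAt_slice (h.analytic_b i) t x

/-! ### An analytic solution with given initial data. -/

section Existence

variable {E₀ B₀ : Space → Fin 3 → ℝ}

/-- The electric component of the solution with initial data `E₀`, `B₀`. -/
def solE (E₀ B₀ : Space → Fin 3 → ℝ) (i : Fin 3) (p : ST) : ℝ :=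
  dd eT (wave (fun x => E₀ x i)) p + stCurl (fun j => wave (fun x => B₀ x j)) i p

/-- The magnetic component of the solution with initial data `E₀`, `B₀`. -/
def solB (E₀ B₀ : Space → Fin 3 → ℝ) (i : Fin 3) (p : ST) : ℝ :=
  dd eT (wave (fun x => B₀ x i)) p - stCurl (fun j => wave (fun x => E₀ x j)) i p

lemma RealAnalytic.component {V : Space → Fin 3 → ℝ} (hV : RealAnalytic V) (i : Fin 3) :
    RealAnalytic (fun x => V x i) := fun x hx =>
  ((ContinuousLinearMap.proj (R := ℝ) (φ := fun _ : Fin 3 => ℝ) i).analyticAt _).comp (hV x hx)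

lemma div_wave {V : Space → Fin 3 → ℝ} (hV : ∀ i, RealAnalytic (fun x => V x i))
    (hdiv : ∀ x, div V x = 0) :
    (fun p => ∑ i, dd (eX i) (wave (fun x => V x i)) p) = 0 := by
  funext p
  have h1 : (fun x => ∑ i, pd i (fun x => V x i) x) = fun _ => 0 := funext hdiv
  have h2 := wave_sum (fun i => (hV i).pd i) p
  rw [h1] at h2
  have h4 : ∀ i, pd i (fun _ : Space => (0 : ℝ)) = fun _ => 0 := fun _ => by
    funext x; simp [pd]
  have h5 : wave (fun _ => (0 : ℝ)) p = 0 := by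
    have : lap (fun _ => (0 : ℝ)) = fun _ => 0 := by
      funext x
      simp [lap, h4]
    simp [wave, this, ballMean]
  rw [h5] at h2
  simp only [dd_eX_wave (hV _), Pi.zero_apply]
  exact h2.symm

lemma dd_eT_dd_eT_wave_eq_sum {f : Space → ℝ} (hf : RealAnalytic f) (p : ST) :
    dd eT (dd eT (wave f)) p = ∑ j, dd (eX j) (dd (eX j) (wave f)) p := by
  rw [dd_eT_dd_eT_wave hf]
  have : wave (lap f) p = ∑ j, wave (pd j (pd j f)) p := wave_sum (fun j => (hf.pd j).pd j) p
  rw [this]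
  refine Finset.sum_congr rfl fun j _ => ?_
  rw [dd_eX_wave hf, dd_eX_wave (hf.pd j)]

lemma sum_dd_stCurl {f : Fin 3 → ST → ℝ} (hf : ∀ i, RealAnalytic (f i)) (p : ST) :
    ∑ i, dd (eX i) (stCurl f i) p = 0 := by
  simp only [dd_stCurl hf]
  simp only [Fin.sum_univ_three]
  have h01 := congrFun (dd_comm (hf 2) (eX 0) (eX 1)) p
  have h02 := congrFun (dd_comm (hf 1) (eX 0) (eX 2)) p
  have h12 := congrFun (dd_comm (hf 0) (eX 1) (eX 2)) p
  simp only [zero_add, Fin.isValue, show (1 : Fin 3) + 1 = 2 from rfl,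
    show (1 : Fin 3) + 2 = 0 from rfl, show (2 : Fin 3) + 1 = 0 from rfl,
    show (2 : Fin 3) + 2 = 1 from rfl]
  linarith

/-- With `φ = wave E₀ + i wave B₀` the field is `F = (∂ₜ - i ∇×) φ`. Since `φ` is divergence-free,
`(∂ₜ + i ∇×)(∂ₜ - i ∇×) φ = (∂ₜ² - Δ) φ = 0`, which is `∂ₜF = -i ∇ × F`. -/
lemma analyticMaxwell_sol (hE₀ : RealAnalytic E₀) (hB₀ : RealAnalytic B₀)
    (hdivE : ∀ x, div E₀ x = 0) (hdivB : ∀ x, div B₀ x = 0) :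
    AnalyticMaxwell (solE E₀ B₀) (solB E₀ B₀) := by
  have ha := fun i => realAnalytic_wave (hE₀.component i)
  have hb := fun i => realAnalytic_wave (hB₀.component i)
  have hda := div_wave (fun i => hE₀.component i) hdivE
  have hdb := div_wave (fun i => hB₀.component i) hdivB
  have wa := fun i => dd_eT_dd_eT_wave_eq_sum (hE₀.component i)
  have wb := fun i => dd_eT_dd_eT_wave_eq_sum (hB₀.component i)
  set a : Fin 3 → ST → ℝ := fun i => wave (fun x => E₀ x i)
  set b : Fin 3 → ST → ℝ := fun i => wave (fun x => B₀ x i)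
  have dE : ∀ v i p, dd v (solE E₀ B₀ i) p = dd v (dd eT (a i)) p + dd v (stCurl b i) p :=
    fun v i p => congrFun (dd_add ((ha i).dd eT) (RealAnalytic.stCurl hb i) v) p
  have dB : ∀ v i p, dd v (solB E₀ B₀ i) p = dd v (dd eT (b i)) p - dd v (stCurl a i) p :=
    fun v i p => congrFun (dd_sub ((hb i).dd eT) (RealAnalytic.stCurl ha i) v) p
  have dT0 : ∀ c : Fin 3 → ST → ℝ, (∀ i, RealAnalytic (c i)) →
      ((fun p => ∑ i, dd (eX i) (c i) p) = 0) → ∀ p, ∑ i, dd (eX i) (dd eT (c i)) p = 0 := by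
    intro c hc hd p
    have h1 := congrFun (dd_sum (s := Finset.univ) (fun j => (hc j).dd (eX j)) eT) p
    rw [hd] at h1
    calc _ = ∑ i, dd eT (dd (eX i) (c i)) p :=
          Finset.sum_congr rfl fun i _ => congrFun (dd_comm (hc i) _ _) p
      _ = 0 := by
        rw [← h1]
        change fderiv ℝ (0 : ST → ℝ) p _ = 0
        simp
  have cc : ∀ c : Fin 3 → ST → ℝ, (∀ i, RealAnalytic (c i)) → ∀ i p,
      dd eT (stCurl c i) p = stCurl (fun j => dd eT (c j)) i p := by
    intro c hc i p
    rw [dd_stCurl hc, stCurl, dd_comm (hc (i + 2)), dd_comm (hc (i + 1))]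
  constructor
  · exact fun i p hp => ((ha i).dd eT p hp).add (RealAnalytic.stCurl hb i p hp)
  · exact fun i p hp => ((hb i).dd eT p hp).sub (RealAnalytic.stCurl ha i p hp)
  · intro p
    simp only [dE, Finset.sum_add_distrib]
    rw [dT0 a ha hda, sum_dd_stCurl (f := b) hb, add_zero]
  · intro p
    simp only [dB, Finset.sum_sub_distrib]
    rw [dT0 b hb hdb, sum_dd_stCurl (f := a) ha, sub_zero]
  · intro i p
    have h1 := stCurl_stCurl ha hda i p
    rw [dE, cc b hb]
    have h2 : stCurl (solB E₀ B₀) i p =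
        stCurl (fun j => dd eT (b j)) i p - stCurl (stCurl a) i p := by
      simp only [stCurl, dB]
      ring
    rw [h2, h1, wa i p]
    ring
  · intro i p
    have h1 := stCurl_stCurl hb hdb i p
    rw [dB, cc a ha]
    have h2 : stCurl (solE E₀ B₀) i p =
        stCurl (fun j => dd eT (a j)) i p + stCurl (stCurl b) i p := by
      simp only [stCurl, dE]
      ring
    rw [h2, h1, wb i p]
    ring

lemma solE_zero (hE₀ : RealAnalytic E₀) (hB₀ : RealAnalytic B₀) :
    (fun x i => solE E₀ B₀ i (0, x)) = E₀ := by
  funext x i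
  have h : ∀ (f : Space → ℝ) j, RealAnalytic f → dd (eX j) (wave f) (0, x) = 0 := fun f j hf => by
    rw [dd_eX_wave hf, wave_zero_left]
  simp [solE, stCurl, dd_eT_wave_zero_left (hE₀.component i), h _ _ (hB₀.component _)]

lemma solB_zero (hE₀ : RealAnalytic E₀) (hB₀ : RealAnalytic B₀) :
    (fun x i => solB E₀ B₀ i (0, x)) = B₀ := by
  funext x i
  have h : ∀ (f : Space → ℝ) j, RealAnalytic f → dd (eX j) (wave f) (0, x) = 0 := fun f j hf => by
    rw [dd_eX_wave hf, wave_zero_left]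
  simp [solB, stCurl, dd_eT_wave_zero_left (hB₀.component i), h _ _ (hE₀.component _)]

end Existence

/-! ### Energy in light cones and uniqueness for zero data. -/

section EnergyEstimate

/-- The function `((R - t)² - |x|²)₊`, positive on the backward light cone with apex `(R, 0)`. -/
def cone (R : ℝ) (p : ST) : ℝ := max 0 ((R - p.1) ^ 2 - ‖p.2‖ ^ 2)

variable {R : ℝ}

lemma continuous_cone : Continuous (cone R) := by unfold cone; fun_prop

lemma cone_nonneg (p : ST) : 0 ≤ cone R p := le_max_left _ _

lemma cone_eq_zero {p : ST} (h0 : 0 ≤ p.1) (hR : p.1 ≤ R)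
    (hp : p.2 ∉ Metric.closedBall (0 : Space) R) : cone R p = 0 := by
  have h : R < ‖p.2‖ := by simpa using hp
  exact max_eq_left (by nlinarith)

lemma norm_le_of_cone_pos {p : ST} (hR : p.1 ≤ R) (h : 0 < cone R p) : ‖p.2‖ ≤ R - p.1 := by
  have h1 : 0 < (R - p.1) ^ 2 - ‖p.2‖ ^ 2 := by
    by_contra hcon
    rw [cone, max_eq_left (not_lt.1 hcon)] at h
    exact lt_irrefl _ h
  exact abs_le_of_sq_le_sq' (by linarith) (by linarith) |>.2

lemma hasDerivAt_cone_sq (t : ℝ) (x : Space) :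
    HasDerivAt (fun s => cone R (s, x) ^ 2) (-4 * cone R (t, x) * (R - t)) t := by
  have h1 : HasDerivAt (fun s : ℝ => (R - s) ^ 2 - ‖x‖ ^ 2) (-2 * (R - t)) t := by
    have := (((hasDerivAt_id t).const_sub R).pow 2).sub_const (‖x‖ ^ 2)
    refine this.congr_deriv ?_
    simp
  refine ((hasDerivAt_max_zero_sq _).comp t h1).congr_deriv ?_
  simp only [cone]
  ring

lemma hasFDerivAt_cone_sq (t : ℝ) (x : Space) :
    HasFDerivAt (fun y => cone R (t, y) ^ 2) ((-4 * cone R (t, x)) • innerSL ℝ x) x := by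
  have h1 : HasFDerivAt (fun y : Space => (R - t) ^ 2 - ‖y‖ ^ 2) (-(2 • innerSL ℝ x)) x :=
    ((hasStrictFDerivAt_norm_sq x).hasFDerivAt).const_sub _
  have h2 := (hasDerivAt_max_zero_sq ((R - t) ^ 2 - ‖x‖ ^ 2)).comp_hasFDerivAt x h1
  have h3 : (2 * max 0 ((R - t) ^ 2 - ‖x‖ ^ 2)) • (-(2 • innerSL ℝ x)) =
      (-4 * cone R (t, x)) • innerSL ℝ x := by
    ext v; simp [cone]; ring
  rw [h3] at h2
  exact h2

lemma pd_cone_sq (t : ℝ) (i : Fin 3) :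
    pd i (fun y => cone R (t, y) ^ 2) = fun x => -4 * cone R (t, x) * x i := by
  funext x
  rw [pd, (hasFDerivAt_cone_sq t x).fderiv]
  simp [EuclideanSpace.inner_single_right]

/-- The energy flux through the light cone is dominated by the energy density. -/
lemma flux_le {ρ : ℝ} {x e b : Fin 3 → ℝ} (hρ : 0 ≤ ρ) (hx : ∑ i, x i ^ 2 ≤ ρ ^ 2) :
    0 ≤ ρ * ∑ i, (e i ^ 2 + b i ^ 2) +
      2 * ∑ i, x i * (e (i + 1) * b (i + 2) - e (i + 2) * b (i + 1)) := by
  set n := ∑ i, (e i ^ 2 + b i ^ 2) with hn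
  set s := ∑ i, x i * (e (i + 1) * b (i + 2) - e (i + 2) * b (i + 1)) with hs
  have hn0 : 0 ≤ n := Finset.sum_nonneg fun i _ => by positivity
  have cs := Finset.sum_mul_sq_le_sq_mul_sq Finset.univ x
    (fun i => e (i + 1) * b (i + 2) - e (i + 2) * b (i + 1))
  have h2 : 4 * ∑ i, (e (i + 1) * b (i + 2) - e (i + 2) * b (i + 1)) ^ 2 ≤ n ^ 2 := by
    rw [hn]
    simp only [Fin.sum_univ_three, zero_add, Fin.isValue, show (1 : Fin 3) + 1 = 2 from rfl,
      show (1 : Fin 3) + 2 = 0 from rfl, show (2 : Fin 3) + 1 = 0 from rfl,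
      show (2 : Fin 3) + 2 = 1 from rfl]
    -- Lagrange's identity `|e × b|² = |e|² |b|² - (e · b)²` together with `4 |e|² |b|² ≤ (|e|² +
    -- |b|²)²`.
    nlinarith [sq_nonneg (e 0 * b 0 + e 1 * b 1 + e 2 * b 2),
      sq_nonneg (e 0 ^ 2 + e 1 ^ 2 + e 2 ^ 2 - (b 0 ^ 2 + b 1 ^ 2 + b 2 ^ 2))]
  have h3 : (2 * s) ^ 2 ≤ (ρ * n) ^ 2 := by
    calc (2 * s) ^ 2 = 4 * s ^ 2 := by ring
      _ ≤ 4 * ((∑ i, x i ^ 2) * ∑ i, (e (i + 1) * b (i + 2) - e (i + 2) * b (i + 1)) ^ 2) := by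
        gcongr
      _ = (∑ i, x i ^ 2) * (4 * ∑ i, (e (i + 1) * b (i + 2) - e (i + 2) * b (i + 1)) ^ 2) := by
        ring
      _ ≤ ρ ^ 2 * n ^ 2 := by
        gcongr
      _ = _ := by ring
  have := (abs_le_of_sq_le_sq' h3 (by positivity)).1
  linarith

variable {e b : Fin 3 → ST → ℝ}

/-- The half space of nonnegative times. -/
abbrev future : Set ST := Set.Ici (0 : ℝ) ×ˢ Set.univ

/-- The half space of positive times. -/
abbrev openFuture : Set ST := Set.Ioi (0 : ℝ) ×ˢ Set.univ

lemma isOpen_openFuture : IsOpen openFuture := isOpen_Ioi.prod isOpen_univ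

lemma openFuture_subset : openFuture ⊆ future :=
  Set.prod_mono Set.Ioi_subset_Ici_self subset_rfl

lemma differentiableAt_of_pos {f : ST → ℝ} (hf : ContDiffOn ℝ 1 f future) {p : ST}
    (hp : 0 < p.1) : DifferentiableAt ℝ f p :=
  ((hf.mono openFuture_subset).contDiffAt
    (isOpen_openFuture.mem_nhds ⟨hp, Set.mem_univ _⟩)).differentiableAt one_ne_zero

lemma continuousOn_dd {f : ST → ℝ} (hf : ContDiffOn ℝ 1 f future) (v : ST) :
    ContinuousOn (dd v f) openFuture :=
  ((hf.mono openFuture_subset).continuousOn_fderiv_of_isOpen isOpen_openFuture le_rfl).clm_apply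
    continuousOn_const

lemma hasDerivAt_time {f : ST → ℝ} (hf : ContDiffOn ℝ 1 f future) {t : ℝ} (ht : 0 < t)
    (x : Space) : HasDerivAt (fun s => f (s, x)) (dd eT f (t, x)) t := by
  have h1 : HasDerivAt (fun s : ℝ => ((s, x) : ST)) eT t :=
    (hasDerivAt_id t).prodMk (hasDerivAt_const t x)
  exact (differentiableAt_of_pos hf ht).hasFDerivAt.comp_hasDerivAt t h1

lemma hasFDerivAt_space {f : ST → ℝ} (hf : ContDiffOn ℝ 1 f future) {t : ℝ} (ht : 0 < t)
    (x : Space) : HasFDerivAt (fun y => f (t, y))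
      ((fderiv ℝ f (t, x)).comp (ContinuousLinearMap.inr ℝ ℝ Space)) x :=
  (differentiableAt_of_pos hf (p := (t, x)) ht).hasFDerivAt.comp x (hasFDerivAt_prodMk_right t x)

lemma continuous_space {f : ST → ℝ} {s : Set ℝ} (hf : ContinuousOn f (s ×ˢ Set.univ)) {t : ℝ}
    (ht : t ∈ s) : Continuous fun y => f (t, y) :=
  hf.comp_continuous (Continuous.prodMk_right t) fun _ => ⟨ht, Set.mem_univ _⟩

/-- Twice the energy density. -/
def density (e b : Fin 3 → ST → ℝ) (p : ST) : ℝ := ∑ i, (e i p ^ 2 + b i p ^ 2)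

/-- The Poynting vector. -/
def flux (e b : Fin 3 → ST → ℝ) (i : Fin 3) (p : ST) : ℝ :=
  e (i + 1) p * b (i + 2) p - e (i + 2) p * b (i + 1) p

/-- Energy in the light cone, with the weight `cone R ^ 2`. -/
def coneEnergy (R : ℝ) (e b : Fin 3 → ST → ℝ) (t : ℝ) : ℝ :=
  ∫ x in Metric.closedBall (0 : Space) R, cone R (t, x) ^ 2 * density e b (t, x)

/-- The time derivative of `cone R ^ 2 * density e b`. -/
def coneRate (R : ℝ) (e b : Fin 3 → ST → ℝ) (p : ST) : ℝ :=
  -4 * cone R p * (R - p.1) * density e b p +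
    cone R p ^ 2 * (2 * ∑ i, (e i p * dd eT (e i) p + b i p * dd eT (b i) p))

lemma continuousOn_density (he : ∀ i, ContDiffOn ℝ 1 (e i) future)
    (hb : ∀ i, ContDiffOn ℝ 1 (b i) future) : ContinuousOn (density e b) future :=
  continuousOn_finsetSum _ fun i _ => ((he i).continuousOn.pow 2).add ((hb i).continuousOn.pow 2)

lemma continuousOn_coneRate (he : ∀ i, ContDiffOn ℝ 1 (e i) future)
    (hb : ∀ i, ContDiffOn ℝ 1 (b i) future) : ContinuousOn (coneRate R e b) openFuture := by
  have h1 := (continuousOn_density he hb).mono openFuture_subset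
  have h2 : Continuous fun p : ST => -4 * cone R p * (R - p.1) :=
    (continuous_const.mul continuous_cone).mul (by fun_prop)
  refine (h2.continuousOn.mul h1).add ((continuous_cone.pow 2).continuousOn.mul
    (continuousOn_const.mul (continuousOn_finsetSum _ fun i _ => ?_)))
  exact (((he i).continuousOn.mono openFuture_subset).mul (continuousOn_dd (he i) eT)).add
    (((hb i).continuousOn.mono openFuture_subset).mul (continuousOn_dd (hb i) eT))

lemma hasDerivAt_cone_density (he : ∀ i, ContDiffOn ℝ 1 (e i) future)
    (hb : ∀ i, ContDiffOn ℝ 1 (b i) future) {t : ℝ} (ht : 0 < t) (x : Space) :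
    HasDerivAt (fun s => cone R (s, x) ^ 2 * density e b (s, x)) (coneRate R e b (t, x)) t := by
  have h1 : HasDerivAt (fun s => density e b (s, x))
      (2 * ∑ i, (e i (t, x) * dd eT (e i) (t, x) + b i (t, x) * dd eT (b i) (t, x))) t := by
    have := HasDerivAt.fun_sum (u := (Finset.univ : Finset (Fin 3))) fun i _ =>
      ((hasDerivAt_time (he i) ht x).pow 2).add ((hasDerivAt_time (hb i) ht x).pow 2)
    refine this.congr_deriv ?_
    rw [Finset.mul_sum]
    refine Finset.sum_congr rfl fun i _ => ?_
    simp; ring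
  exact ((hasDerivAt_cone_sq t x).mul h1).congr_deriv rfl

lemma hasDerivAt_coneEnergy (he : ∀ i, ContDiffOn ℝ 1 (e i) future)
    (hb : ∀ i, ContDiffOn ℝ 1 (b i) future) {t : ℝ} (ht : 0 < t) :
    HasDerivAt (coneEnergy R e b)
      (∫ x in Metric.closedBall (0 : Space) R, coneRate R e b (t, x)) t := by
  have hK := isCompact_closedBall (0 : Space) R
  have hKm : MeasurableSet (Metric.closedBall (0 : Space) R) :=
    Metric.isClosed_closedBall.measurableSet
  have hsub : Set.Icc (t / 2) (2 * t) ×ˢ Metric.closedBall (0 : Space) R ⊆ openFuture :=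
    fun p hp => ⟨lt_of_lt_of_le (by positivity) hp.1.1, Set.mem_univ _⟩
  obtain ⟨C, hC⟩ := (isCompact_Icc.prod hK).exists_bound_of_continuousOn
    ((continuousOn_coneRate (R := R) he hb).mono hsub)
  have hc : ∀ s : ℝ, 0 ≤ s → Continuous fun x : Space => cone R (s, x) ^ 2 * density e b (s, x) :=
    fun s hs => continuous_space (((continuous_cone.pow 2).continuousOn).mul
      (continuousOn_density he hb)) hs
  have hpos : Set.Icc (t / 2) (2 * t) ∈ 𝓝 t := Icc_mem_nhds (by linarith) (by linarith)
  refine (hasDerivAt_integral_of_dominated_loc_of_deriv_le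
    (F := fun s x => cone R (s, x) ^ 2 * density e b (s, x))
    (F' := fun s x => coneRate R e b (s, x)) (bound := fun _ => C)
    hpos ?_ ?_ ?_ ?_ ?_ ?_).2
  · filter_upwards [hpos] with s hs
    exact ((hc s (by linarith [hs.1])).continuousOn).aestronglyMeasurable_of_isCompact hK hKm
  · exact (hc t ht.le).continuousOn.integrableOn_compact hK
  · exact (continuous_space (continuousOn_coneRate he hb) ht).continuousOn
      |>.aestronglyMeasurable_of_isCompact hK hKm
  · exact (ae_restrict_iff' hKm).2 (Eventually.of_forall fun x hx s hs => hC (s, x) ⟨hs, hx⟩)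
  · exact integrableOn_const hK.measure_ne_top
  · exact Eventually.of_forall fun x s hs =>
      hasDerivAt_cone_density he hb (by linarith [hs.1]) x

/-- The rate of change is computed only for `t > 0`, where the fields have two-sided derivatives;
continuity carries the monotonicity down to the initial time. -/
lemma continuousOn_coneEnergy (he : ∀ i, ContDiffOn ℝ 1 (e i) future)
    (hb : ∀ i, ContDiffOn ℝ 1 (b i) future) :
    ContinuousOn (coneEnergy R e b) (Set.Icc 0 R) := by
  refine continuousOn_integral_of_compact_support (isCompact_closedBall (0 : Space) R) ?_ ?_
  · refine (((continuous_cone (R := R)).pow 2).continuousOn.mul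
      (continuousOn_density he hb)).mono ?_
    exact Set.prod_mono Set.Icc_subset_Ici_self subset_rfl
  · intro t x ht hx
    rw [cone_eq_zero (p := (t, x)) ht.1 ht.2 hx]
    ring

/-- Poynting's theorem. -/
lemma sum_mul_dd_eq (he : ∀ i, ContDiffOn ℝ 1 (e i) future)
    (hb : ∀ i, ContDiffOn ℝ 1 (b i) future)
    (hA : ∀ i p, 0 < p.1 → dd eT (e i) p = stCurl b i p)
    (hF : ∀ i p, 0 < p.1 → dd eT (b i) p = - stCurl e i p) {t : ℝ} (ht : 0 < t) (x : Space) :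
    ∑ i, (e i (t, x) * dd eT (e i) (t, x) + b i (t, x) * dd eT (b i) (t, x)) =
      - ∑ i, pd i (fun y => flux e b i (t, y)) x := by
  have h1 : ∀ i j, pd i (fun y => flux e b j (t, y)) x =
      e (j + 1) (t, x) * dd (eX i) (b (j + 2)) (t, x) +
        dd (eX i) (e (j + 1)) (t, x) * b (j + 2) (t, x) -
      (e (j + 2) (t, x) * dd (eX i) (b (j + 1)) (t, x) +
        dd (eX i) (e (j + 2)) (t, x) * b (j + 1) (t, x)) := by
    intro i j
    have h2 := ((hasFDerivAt_space (he (j + 1)) ht x).mul (hasFDerivAt_space (hb (j + 2)) ht x)).sub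
      ((hasFDerivAt_space (he (j + 2)) ht x).mul (hasFDerivAt_space (hb (j + 1)) ht x))
    have h3 : pd i (fun y => flux e b j (t, y)) x = _ :=
      congrArg (fun L => L (EuclideanSpace.single i 1)) h2.fderiv
    rw [h3]
    simp [dd, eX]
    ring
  simp only [h1, hA _ (t, x) ht, hF _ (t, x) ht, stCurl]
  simp only [Fin.sum_univ_three, zero_add, Fin.isValue, show (1 : Fin 3) + 1 = 2 from rfl,
      show (1 : Fin 3) + 2 = 0 from rfl, show (2 : Fin 3) + 1 = 0 from rfl,
      show (2 : Fin 3) + 2 = 1 from rfl]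
  ring

lemma contDiff_flux (he : ∀ i, ContDiffOn ℝ 1 (e i) future)
    (hb : ∀ i, ContDiffOn ℝ 1 (b i) future) {t : ℝ} (ht : 0 < t) (i : Fin 3) :
    ContDiff ℝ 1 (fun y => flux e b i (t, y)) := by
  have h : ∀ f : ST → ℝ, ContDiffOn ℝ 1 f future → ContDiff ℝ 1 fun y => f (t, y) := by
    intro f hf
    refine contDiffOn_univ.1 (hf.comp (g := f) (f := fun y : Space => ((t, y) : ST))
      (contDiff_prodMk_right t).contDiffOn fun y _ => ⟨ht.le, Set.mem_univ _⟩)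
  exact ((h _ (he _)).mul (h _ (hb _))).sub ((h _ (he _)).mul (h _ (hb _)))

/-- Poynting's theorem and integration by parts turn the integrand into `-4 cone · ((R - t) density
+ 2 x · flux)`. Where `cone > 0` one has `|x| ≤ R - t`, and `2 |flux| ≤ density`, so it is
nonpositive. -/
lemma integral_coneRate_nonpos (he : ∀ i, ContDiffOn ℝ 1 (e i) future)
    (hb : ∀ i, ContDiffOn ℝ 1 (b i) future)
    (hA : ∀ i p, 0 < p.1 → dd eT (e i) p = stCurl b i p)
    (hF : ∀ i p, 0 < p.1 → dd eT (b i) p = - stCurl e i p) {t : ℝ} (ht : 0 < t) (htR : t < R) :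
    ∫ x in Metric.closedBall (0 : Space) R, coneRate R e b (t, x) ≤ 0 := by
  have hK := isCompact_closedBall (0 : Space) R
  have hz : ∀ x ∉ Metric.closedBall (0 : Space) R, cone R (t, x) = 0 := fun x hx =>
    cone_eq_zero (p := (t, x)) ht.le htR.le hx
  have hcone : Continuous fun x : Space => cone R (t, x) :=
    continuous_cone.comp (Continuous.prodMk_right t)
  have hfl := fun i => contDiff_flux he hb ht i
  have hfl' : ∀ i, Continuous (pd i fun y => flux e b i (t, y)) := fun i =>
    ((hfl i).continuous_fderiv one_ne_zero).clm_apply continuous_const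
  have hden : Continuous fun x => density e b (t, x) :=
    continuous_space (continuousOn_density he hb) ht.le
  have hsupp : ∀ {f : Space → ℝ}, Continuous f → (∀ x ∉ Metric.closedBall (0 : Space) R, f x = 0) →
      Integrable f := fun hf h0 =>
    hf.integrable_of_hasCompactSupport (HasCompactSupport.intro hK h0)
  have hc1 : Continuous fun x : Space => -4 * cone R (t, x) * (R - t) * density e b (t, x) :=
    ((continuous_const.mul hcone).mul continuous_const).mul hden
  have hc2 : ∀ i, Continuous fun x : Space =>
      cone R (t, x) ^ 2 * pd i (fun y => flux e b i (t, y)) x := fun i =>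
    (hcone.pow 2).mul (hfl' i)
  have hc3 : ∀ i : Fin 3, Continuous fun x : Space =>
      -4 * cone R (t, x) * x i * flux e b i (t, x) := fun i =>
    ((continuous_const.mul hcone).mul (by fun_prop)).mul (hfl i).continuous
  have ibp : ∀ i, ∫ x, cone R (t, x) ^ 2 * pd i (fun y => flux e b i (t, y)) x =
      - ∫ x : Space, -4 * cone R (t, x) * x i * flux e b i (t, x) := by
    intro i
    have hpd : ∀ x, fderiv ℝ (fun y => cone R (t, y) ^ 2) x (EuclideanSpace.single i 1) =
        -4 * cone R (t, x) * x i := fun x => congrFun (pd_cone_sq t i) x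
    have := integral_mul_fderiv_eq_neg_fderiv_mul_of_integrable (μ := (volume : Measure Space))
      (f := fun x => cone R (t, x) ^ 2) (g := fun x => flux e b i (t, x))
      (v := EuclideanSpace.single i 1) ?_ ?_ ?_
      (fun x _ => (hasFDerivAt_cone_sq t x).differentiableAt)
      (fun x _ => (hfl i).differentiable one_ne_zero x)
    · simp only [hpd] at this
      exact this
    · simp only [hpd]
      exact hsupp (hc3 i) fun x hx => by simp [hz x hx]
    · exact hsupp (hc2 i) fun x hx => by simp [hz x hx]
    · exact hsupp ((hcone.pow 2).mul (hfl i).continuous) fun x hx => by simp [hz x hx]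
  have hrate : ∀ x, coneRate R e b (t, x) = -4 * cone R (t, x) * (R - t) * density e b (t, x) -
      2 * ∑ i, cone R (t, x) ^ 2 * pd i (fun y => flux e b i (t, y)) x := by
    intro x
    rw [coneRate, sum_mul_dd_eq he hb hA hF ht x, ← Finset.mul_sum]
    ring
  rw [setIntegral_eq_integral_of_forall_compl_eq_zero (fun x hx => by rw [hrate]; simp [hz x hx])]
  have i1 := hsupp hc1 fun x hx => by simp [hz x hx]
  have i2 := fun i => hsupp (hc2 i) fun x hx => by simp [hz x hx]
  have i3 := fun i => hsupp (hc3 i) fun x hx => by simp [hz x hx]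
  have e1 : ∫ x, coneRate R e b (t, x) = ∫ x, (-4 * cone R (t, x) * (R - t) * density e b (t, x) +
      2 * ∑ i, -4 * cone R (t, x) * x i * flux e b i (t, x)) := by
    simp only [hrate]
    rw [integral_sub i1 ((integrable_finsetSum _ fun i _ => i2 i).const_mul 2),
      integral_add i1 ((integrable_finsetSum _ fun i _ => i3 i).const_mul 2),
      integral_const_mul, integral_const_mul, integral_finsetSum _ fun i _ => i2 i,
      integral_finsetSum _ fun i _ => i3 i]
    simp only [ibp, Finset.sum_neg_distrib]
    ring
  rw [e1]
  refine integral_nonpos fun x => ?_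
  rcases (cone_nonneg (R := R) (t, x)).eq_or_lt with h | h
  · simp [← h]
  · have hx : ‖x‖ ≤ R - t := norm_le_of_cone_pos (p := (t, x)) htR.le h
    have hx2 : ∑ i, x i ^ 2 ≤ (R - t) ^ 2 := by
      have : ∑ i, x i ^ 2 = ‖x‖ ^ 2 := by
        rw [EuclideanSpace.norm_sq_eq]; simp
      rw [this]; gcongr
    have hfl := flux_le (e := fun i => e i (t, x)) (b := fun i => b i (t, x))
      (by linarith : 0 ≤ R - t) hx2
    have e2 : -4 * cone R (t, x) * (R - t) * density e b (t, x) +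
        2 * ∑ i, -4 * cone R (t, x) * x i * flux e b i (t, x) =
        -(4 * cone R (t, x) * ((R - t) * ∑ i, (e i (t, x) ^ 2 + b i (t, x) ^ 2) +
        2 * ∑ i, x i * (e (i + 1) (t, x) * b (i + 2) (t, x) -
          e (i + 2) (t, x) * b (i + 1) (t, x)))) := by
      simp only [density, flux, Fin.sum_univ_three]
      ring
    simp only [Pi.zero_apply]
    rw [e2, neg_nonpos]
    exact mul_nonneg (by positivity) hfl

/-- A `C¹` solution of Maxwell's equations with zero initial data vanishes at later times. -/
theorem eq_zero_of_initial_eq_zero (he : ∀ i, ContDiffOn ℝ 1 (e i) future)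
    (hb : ∀ i, ContDiffOn ℝ 1 (b i) future)
    (hA : ∀ i p, 0 < p.1 → dd eT (e i) p = stCurl b i p)
    (hF : ∀ i p, 0 < p.1 → dd eT (b i) p = - stCurl e i p)
    (he0 : ∀ i x, e i (0, x) = 0) (hb0 : ∀ i x, b i (0, x) = 0) {t : ℝ} (ht : 0 ≤ t) (x : Space)
    (i : Fin 3) : e i (t, x) = 0 ∧ b i (t, x) = 0 := by
  -- The point `(t, x)` then lies strictly inside the cone with apex `(R, 0)`, where the weight is
  -- positive.
  set R := t + ‖x‖ + 1 with hR
  have htR : t ∈ Set.Icc 0 R := ⟨ht, by rw [hR]; linarith [norm_nonneg x]⟩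
  have hanti : AntitoneOn (coneEnergy R e b) (Set.Icc 0 R) := by
    refine antitoneOn_of_deriv_nonpos (convex_Icc 0 R) (continuousOn_coneEnergy he hb) ?_ ?_
    · rw [interior_Icc]
      exact fun s hs =>
        (hasDerivAt_coneEnergy he hb hs.1).differentiableAt.differentiableWithinAt
    · rw [interior_Icc]
      intro s hs
      rw [(hasDerivAt_coneEnergy he hb hs.1).deriv]
      exact integral_coneRate_nonpos he hb hA hF hs.1 hs.2
  have h0 : coneEnergy R e b 0 = 0 := by simp [coneEnergy, density, he0, hb0]
  have h1 : coneEnergy R e b t ≤ 0 := h0 ▸ hanti ⟨le_rfl, htR.1.trans htR.2⟩ htR ht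
  have hden0 : ∀ p, 0 ≤ density e b p := fun p => Finset.sum_nonneg fun i _ => by positivity
  have hcp : 0 < cone R (t, x) := by
    refine lt_max_of_lt_right ?_
    have : ‖x‖ < R - t := by rw [hR]; linarith
    have h2 := norm_nonneg x
    simp only
    nlinarith
  have hd : density e b (t, x) = 0 := by
    by_contra hne
    have hc : Continuous fun x : Space => cone R (t, x) ^ 2 * density e b (t, x) :=
      continuous_space (((continuous_cone.pow 2).continuousOn).mul (continuousOn_density he hb)) ht
    have hz : ∀ x ∉ Metric.closedBall (0 : Space) R,
        cone R (t, x) ^ 2 * density e b (t, x) = 0 := fun x hx => by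
      rw [cone_eq_zero (p := (t, x)) ht htR.2 hx]; ring
    have h2 : 0 < ∫ x, cone R (t, x) ^ 2 * density e b (t, x) :=
      hc.integral_pos_of_hasCompactSupport_nonneg_nonzero
        (HasCompactSupport.intro (isCompact_closedBall _ _) hz)
        (fun y => mul_nonneg (sq_nonneg _) (hden0 _)) (x := x)
        (mul_ne_zero (pow_ne_zero 2 hcp.ne') hne)
    rw [← setIntegral_eq_integral_of_forall_compl_eq_zero hz] at h2
    exact absurd h1 (not_le.2 h2)
  have h3 := (Finset.sum_eq_zero_iff_of_nonneg (fun i _ => by positivity)).1 hd i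
    (Finset.mem_univ i)
  constructor <;> nlinarith [sq_nonneg (e i (t, x)), sq_nonneg (b i (t, x))]

end EnergyEstimate

/-! ### Division by powers of time. -/

section DivisionByTime

variable {A : Type*} [NormedAddCommGroup A] [NormedSpace ℝ A]

/-- The linear map `(t, x) ↦ (s t, x)`. -/
def timeScale (s : ℝ) : ST →L[ℝ] ST :=
  s • (ContinuousLinearMap.inl ℝ ℝ Space).comp (ContinuousLinearMap.fst ℝ ℝ Space) +
    (ContinuousLinearMap.inr ℝ ℝ Space).comp (ContinuousLinearMap.snd ℝ ℝ Space)

lemma timeScale_apply (s : ℝ) (p : ST) : timeScale s p = (s * p.1, p.2) := by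
  simp [timeScale]

lemma continuous_timeScale : Continuous timeScale :=
  (continuous_id.smul continuous_const).add continuous_const

/-- An analytic function that vanishes at `t = 0` is divisible by `t`. -/
lemma exists_eq_fst_smul [CompleteSpace A] {M : ST → A} (hM : RealAnalytic M)
    (h0 : ∀ x, M (0, x) = 0) :
    ∃ M' : ST → A, RealAnalytic M' ∧ ∀ p, M p = p.1 • M' p := by
  -- Hadamard's formula `M(t, x) = t ∫₀¹ ∂ₜM(st, x) ds`. The factor `1 •` is a constant weight,
  -- matching the form of the parametric integral theorem.
  refine ⟨fun p => ∫ s in Set.Icc (0 : ℝ) 1, (1 : ℝ) • dd eT M (timeScale s p),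
    analyticOnNhd_integral_comp (hM.dd eT) isCompact_Icc measurableSet_Icc continuous_const
      continuous_timeScale, fun p => ?_⟩
  simp only [one_smul, timeScale_apply]
  rw [integral_Icc_eq_integral_Ioc, ← intervalIntegral.integral_of_le zero_le_one,
    ← intervalIntegral.integral_smul]
  have hd : ∀ s ∈ Set.uIcc (0 : ℝ) 1, HasDerivAt (fun s => M (s * p.1, p.2))
      (p.1 • dd eT M (s * p.1, p.2)) s := fun s _ => by
    have h1 : HasDerivAt (fun s : ℝ => s * p.1) p.1 s := by
      simpa using (hasDerivAt_id s).mul_const p.1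
    exact (hasDerivAt_slice hM (s * p.1) p.2).scomp s h1
  have hc : Continuous fun s : ℝ => p.1 • dd eT M (s * p.1, p.2) :=
    continuous_const.smul (((hM.dd eT).contDiff (n := 0)).continuous.comp (by fun_prop))
  rw [intervalIntegral.integral_eq_sub_of_hasDerivAt hd (hc.intervalIntegrable _ _)]
  simp [h0]

lemma dd_eT_of_eq_pow_smul {N M : ST → A} (hN : RealAnalytic N) (hM : RealAnalytic M) {n : ℕ}
    (h : ∀ p, N p = p.1 ^ (n + 1) • M p) (p : ST) :
    dd eT N p = p.1 ^ n • (((n : ℝ) + 1) • M p + p.1 • dd eT M p) := by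
  refine dd_eT_eq hN ?_
  have h1 := (hasDerivAt_pow (n + 1) p.1).fun_smul (hasDerivAt_slice hM p.1 p.2)
  simp only [h]
  refine h1.congr_deriv ?_
  simp only [Nat.add_sub_cancel, Nat.cast_add, Nat.cast_one]
  module

lemma dd_eX_of_eq_pow_smul {N M : ST → A} (hN : RealAnalytic N) (hM : RealAnalytic M) {n : ℕ}
    (h : ∀ p, N p = p.1 ^ n • M p) (i : Fin 3) (p : ST) :
    dd (eX i) N p = p.1 ^ n • dd (eX i) M p := by
  have h1 := (hasFDerivAt_slice hM p.1 p.2).const_smul (p.1 ^ n)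
  have h2 := hasFDerivAt_slice hN p.1 p.2
  have h3 : (fun y => N (p.1, y)) = fun y => p.1 ^ n • M (p.1, y) := funext fun y => h (p.1, y)
  rw [h3] at h2
  have h4 := congrArg (fun L => L (EuclideanSpace.single i 1)) (h2.unique h1)
  exact h4

/-- Unique continuation in time from infinite order of vanishing. -/
lemma eq_zero_of_forall_pow_smul {N : ST → A} (hN : RealAnalytic N)
    (h : ∀ m : ℕ, ∃ M : ST → A, RealAnalytic M ∧ ∀ p, N p = p.1 ^ m • M p) (p : ST) : N p = 0 := by
  have hline : ∀ {M : ST → A}, RealAnalytic M → RealAnalytic fun t : ℝ => M (t, p.2) := by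
    intro M hM t ht
    exact (hM (t, p.2) (Set.mem_univ _)).comp (f := fun t : ℝ => ((t, p.2) : ST))
      (analyticAt_id.prod analyticAt_const)
  have htop : analyticOrderAt (fun t : ℝ => N (t, p.2)) 0 = ⊤ := by
    refine ENat.eq_top_iff_forall_ge.2 fun m => ?_
    rw [natCast_le_analyticOrderAt (hline hN 0 (Set.mem_univ _))]
    obtain ⟨M, hM, hNM⟩ := h m
    exact ⟨_, hline hM 0 (Set.mem_univ _), Eventually.of_forall fun t => by simp [hNM]⟩
  rw [analyticOrderAt_eq_top] at htop
  exact (hline hN).eqOn_zero_of_preconnected_of_eventuallyEq_zero isPreconnected_univ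
    (Set.mem_univ 0) htop (Set.mem_univ p.1)

end DivisionByTime

/-! ### Propagation of the null condition. -/

section NullPropagation

open Complex

/-- With `g i j = ∂ᵢ fⱼ` and `∇ · f = 0`, the quadratic expression `|∇ × f|² + |∇ f|²` lies, up to
a factor `f₂²`, in the ideal generated by `f · f`, `∇ (f · f)` and `f · ∇ × f`. -/
lemma null_identity {f0 f1 f2 g00 g01 g02 g10 g11 g12 g20 g21 g22 : ℂ}
    (htr : g00 + g11 + g22 = 0) :
    f2 ^ 2 * ((g12 - g21) ^ 2 + (g20 - g02) ^ 2 + (g01 - g10) ^ 2 +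
      (g00 ^ 2 + g01 ^ 2 + g02 ^ 2 + (g10 ^ 2 + g11 ^ 2 + g12 ^ 2) +
        (g20 ^ 2 + g21 ^ 2 + g22 ^ 2))) =
    (f0 ^ 2 + f1 ^ 2 + f2 ^ 2) * (2 * (g01 * g10 - g00 * g11 - g02 * g20 - g12 * g21
        + g20 ^ 2 + g21 ^ 2)) +
    (g00 * f0 + g01 * f1 + g02 * f2) * (2 * (f0 * g11 - f1 * g10 + f2 * g02)) +
    (g10 * f0 + g11 * f1 + g12 * f2) * (2 * (f1 * g00 - f0 * g01 + f2 * g12)) +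
    (g20 * f0 + g21 * f1 + g22 * f2) *
      (2 * (f0 * (g02 - g20) + f1 * (g12 - g21) + f2 * g22)) +
    (f0 * (g12 - g21) + f1 * (g20 - g02) + f2 * (g01 - g10)) *
      (2 * (f0 * g21 - f1 * g20 + f2 * (g01 - g10))) := by
  -- The identity reflects the following. If `f ≠ 0` is null and `∇ (f · f) = 0`, every row of `g`
  -- lies in the plane orthogonal to `f`, spanned by `f` and some `m` with `m · f = 0`, `m · m = 1`;
  -- so `g = a ⊗ f + c ⊗ m`. As `m × f = ± i f`, the condition `f · ∇ × f = 0` gives `c · f = 0`, so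
  -- `c = λ f + μ m`, and trace zero gives `a · f = -μ`. The quadratic expression is `2 tr (g gᵀ) -
  -- tr (g²) = 2μ² - 2μ² = 0`.
  obtain rfl : g22 = -(g00 + g11) := by linear_combination htr
  ring

variable {F : Fin 3 → ST → ℂ}

/-- The complex square `F · F`. -/
def sqF (F : Fin 3 → ST → ℂ) (p : ST) : ℂ := ∑ i, F i p * F i p

lemma realAnalytic_sqF (hF : ∀ i, RealAnalytic (F i)) : RealAnalytic (sqF F) :=
  Finset.analyticOnNhd_fun_sum _ fun i _ p hp => (hF i p hp).mul (hF i p hp)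

lemma dd_sqF (hF : ∀ i, RealAnalytic (F i)) (v : ST) :
    dd v (sqF F) = fun p => ∑ i, 2 * (F i p * dd v (F i) p) := by
  have h1 : sqF F = fun p => ∑ i, F i p * F i p := rfl
  rw [h1, dd_sum (f := fun i p => F i p * F i p) fun i p hp => (hF i p hp).mul (hF i p hp)]
  funext p
  refine Finset.sum_congr rfl fun i _ => ?_
  rw [dd_mul (hF i) (hF i)]
  ring

lemma dd_dd_sqF (hF : ∀ i, RealAnalytic (F i)) (v : ST) (p : ST) :
    dd v (dd v (sqF F)) p = ∑ i, 2 * (F i p * dd v (dd v (F i)) p + dd v (F i) p ^ 2) := by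
  rw [dd_sqF hF, dd_sum (f := fun i p => 2 * (F i p * dd v (F i) p)) fun i p hp =>
    analyticAt_const.mul ((hF i p hp).mul ((hF i).dd v p hp))]
  refine Finset.sum_congr rfl fun i _ => ?_
  have h1 : RealAnalytic fun p => F i p * dd v (F i) p :=
    fun p hp => (hF i p hp).mul ((hF i).dd v p hp)
  rw [dd_mul (f := fun _ => (2 : ℂ)) (fun _ _ => analyticAt_const) h1, dd_mul (hF i) ((hF i).dd v)]
  have : dd v (fun _ : ST => (2 : ℂ)) p = 0 := by simp [dd]
  simp only [this]
  ring

lemma dd_eT_dd_eT_F (hF : ∀ i, RealAnalytic (F i))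
    (hdiv : ∀ p, ∑ i, dd (eX i) (F i) p = 0)
    (hmax : ∀ i p, dd eT (F i) p = -I * stCurl F i p) (i : Fin 3) (p : ST) :
    dd eT (dd eT (F i)) p = ∑ j, dd (eX j) (dd (eX j) (F i)) p := by
  have hm : ∀ i, dd eT (F i) = fun p => (-I) * stCurl F i p := fun i => funext (hmax i)
  have hmul : ∀ v i p, dd v (fun p => (-I) * stCurl F i p) p = (-I) * dd v (stCurl F i) p := by
    intro v i p
    rw [dd_mul (f := fun _ => (-I)) (fun _ _ => analyticAt_const) (RealAnalytic.stCurl hF i)]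
    simp [dd]
  have h1 := stCurl_stCurl hF (funext hdiv) i p
  have h2 : stCurl (fun j => dd eT (F j)) i p = -I * stCurl (stCurl F) i p := by
    rw [stCurl, hm, hm, hmul, hmul, stCurl]
    ring
  have h3 : dd eT (stCurl F i) p = stCurl (fun j => dd eT (F j)) i p := by
    rw [dd_stCurl hF, stCurl, dd_comm (hF (i + 2)), dd_comm (hF (i + 1))]
  rw [hm i, hmul, h3, h2, h1]
  linear_combination (-∑ j, dd (eX j) (dd (eX j) (F i)) p) * I_mul_I

/-- `F · F` satisfies a linear wave equation with continuous coefficients wherever `F k ≠ 0`. -/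
lemma exists_wave_equation_sqF (hF : ∀ i, RealAnalytic (F i))
    (hdiv : ∀ p, ∑ i, dd (eX i) (F i) p = 0)
    (hmax : ∀ i p, dd eT (F i) p = -I * stCurl F i p) (k : Fin 3) :
    ∃ α γ : ST → ℂ, ∃ β : Fin 3 → ST → ℂ, Continuous α ∧ Continuous γ ∧ (∀ i, Continuous (β i)) ∧
      ∀ p, F k p ^ 2 * (dd eT (dd eT (sqF F)) p - ∑ j, dd (eX j) (dd (eX j) (sqF F)) p) =
        α p * sqF F p + γ p * dd eT (sqF F) p + ∑ j, β j p * dd (eX j) (sqF F) p := by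
  have cF : ∀ i, Continuous (F i) := fun i => ((hF i).contDiff (n := 0)).continuous
  set g : Fin 3 → Fin 3 → ST → ℂ := fun i j => dd (eX i) (F j) with hg
  have cg : ∀ i j, Continuous (g i j) := fun i j =>
    (((hF j).dd (eX i)).contDiff (n := 0)).continuous
  let β0 : ST → ℂ := fun p => F (k + 1) p * g (k + 2) (k + 2) p - F (k + 2) p * g (k + 2) (k + 1) p
    + F k p * g (k + 1) k p
  let β1 : ST → ℂ := fun p => F (k + 2) p * g (k + 1) (k + 1) p - F (k + 1) p * g (k + 1) (k + 2) p
    + F k p * g (k + 2) k p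
  let β2 : ST → ℂ := fun p => F (k + 1) p * (g (k + 1) k p - g k (k + 1) p) +
    F (k + 2) p * (g (k + 2) k p - g k (k + 2) p) + F k p * g k k p
  have hk1 : k + 1 ≠ k := by fin_cases k <;> decide
  have hk2 : k + 2 ≠ k := by fin_cases k <;> decide
  have hk12 : k + 2 ≠ k + 1 := by fin_cases k <;> decide
  -- The component `k` plays the part of `f2` in `null_identity`. The numerical factors come from
  -- the `-2` in `hbox`, from `F · ∂ⱼF = ½ ∂ⱼ(F · F)` and from `F · (∇ × F) = (i/2) ∂ₜ(F · F)`.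
  refine ⟨fun p => -4 * (g (k + 1) (k + 2) p * g (k + 2) (k + 1) p -
      g (k + 1) (k + 1) p * g (k + 2) (k + 2) p - g (k + 1) k p * g k (k + 1) p -
      g (k + 2) k p * g k (k + 2) p + g k (k + 1) p ^ 2 + g k (k + 2) p ^ 2),
    fun p => -2 * I * (F (k + 1) p * g k (k + 2) p - F (k + 2) p * g k (k + 1) p +
      F k p * (g (k + 1) (k + 2) p - g (k + 2) (k + 1) p)),
    fun j p => -2 * (if j = k then β2 p else if j = k + 1 then β0 p else β1 p), ?_, ?_, ?_, ?_⟩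
  · fun_prop
  · fun_prop
  · intro j
    dsimp only
    split_ifs <;> fun_prop
  · intro p
    have hid := null_identity (f0 := F (k + 1) p) (f1 := F (k + 2) p) (f2 := F k p)
      (g00 := g (k + 1) (k + 1) p) (g01 := g (k + 1) (k + 2) p) (g02 := g (k + 1) k p)
      (g10 := g (k + 2) (k + 1) p) (g11 := g (k + 2) (k + 2) p) (g12 := g (k + 2) k p)
      (g20 := g k (k + 1) p) (g21 := g k (k + 2) p) (g22 := g k k p)
      (by have := hdiv p; rw [sum_cyclic _ k] at this; linear_combination this)
    -- Second derivatives of `F` cancel by its own wave equation; only squares of first derivatives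
    -- survive.
    have hbox : dd eT (dd eT (sqF F)) p - ∑ j, dd (eX j) (dd (eX j) (sqF F)) p =
        -2 * ∑ i, (stCurl F i p ^ 2 + ∑ j, g j i p ^ 2) := by
      simp only [dd_dd_sqF hF, dd_eT_dd_eT_F hF hdiv hmax, hmax, hg]
      rw [Finset.sum_comm, ← Finset.sum_sub_distrib, Finset.mul_sum]
      refine Finset.sum_congr rfl fun i _ => ?_
      simp only [Fin.sum_univ_three]
      linear_combination (2 * stCurl F i p ^ 2) * I_sq
    rw [hbox, dd_sqF hF, sum_cyclic (fun j => _ * dd (eX j) (sqF F) p) k]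
    simp only [dd_sqF hF, hmax, sqF, if_true, if_neg hk1, if_neg hk2, if_neg hk12]
    have e1 : ∑ i, (stCurl F i p ^ 2 + ∑ j, g j i p ^ 2) =
        (g (k + 2) k p - g k (k + 2) p) ^ 2 + (g k (k + 1) p - g (k + 1) k p) ^ 2 +
        (g (k + 1) (k + 2) p - g (k + 2) (k + 1) p) ^ 2 +
        (g (k + 1) (k + 1) p ^ 2 + g (k + 1) (k + 2) p ^ 2 + g (k + 1) k p ^ 2 +
          (g (k + 2) (k + 1) p ^ 2 + g (k + 2) (k + 2) p ^ 2 + g (k + 2) k p ^ 2) +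
        (g k (k + 1) p ^ 2 + g k (k + 2) p ^ 2 + g k k p ^ 2)) := by
      rw [sum_cyclic _ k]
      simp only [sum_cyclic _ k, stCurl, add_two_add_one, add_two_add_two, add_one_add_one,
        add_one_add_two, hg]
      ring
    rw [e1]
    simp only [sum_cyclic _ k, stCurl, add_two_add_one, add_two_add_two, add_one_add_one,
        add_one_add_two]
    simp only [hg, β0, β1, β2] at hid ⊢
    linear_combination (-2) * hid - 4 * (F (k + 1) p * dd (eX k) (F (k + 2)) p -
      F (k + 2) p * dd (eX k) (F (k + 1)) p + F k p * (dd (eX (k + 1)) (F (k + 2)) p -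
      dd (eX (k + 2)) (F (k + 1)) p)) * (F (k + 1) p * (dd (eX (k + 2)) (F k) p -
      dd (eX k) (F (k + 2)) p) + F (k + 2) p * (dd (eX k) (F (k + 1)) p - dd (eX (k + 1)) (F k) p) +
      F k p * (dd (eX (k + 1)) (F (k + 2)) p - dd (eX (k + 2)) (F (k + 1)) p)) * I_sq

/-- The null condition and its first time derivative at `t = 0` propagate. -/
theorem sqF_eq_zero (hF : ∀ i, RealAnalytic (F i))
    (hdiv : ∀ p, ∑ i, dd (eX i) (F i) p = 0)
    (hmax : ∀ i p, dd eT (F i) p = -I * stCurl F i p)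
    (hN : ∀ x, sqF F (0, x) = 0) (hS : ∀ x, ∑ i, F i (0, x) * stCurl F i (0, x) = 0)
    {k : Fin 3} {x₀ : Space} (hx₀ : F k (0, x₀) ≠ 0) (p : ST) : sqF F p = 0 := by
  have hA := realAnalytic_sqF hF
  have hcF : Continuous (F k) := ((hF k).contDiff (n := 0)).continuous
  obtain ⟨α, γ, β, hα, hγ, hβ, heq⟩ := exists_wave_equation_sqF hF hdiv hmax k
  have hone : ∃ M : ST → ℂ, RealAnalytic M ∧ ∀ p, sqF F p = p.1 ^ (0 + 1) • M p := by
    obtain ⟨M, hM, h⟩ := exists_eq_fst_smul hA hN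
    exact ⟨M, hM, fun p => by simpa using h p⟩
  -- The first-order coefficient at `t = 0` is `∂ₜ(F · F) = -2i F · (∇ × F)`, zero by `hS`.
  have htwo : ∃ M : ST → ℂ, RealAnalytic M ∧ ∀ p, sqF F p = p.1 ^ 2 • M p := by
    obtain ⟨M, hM, h⟩ := hone
    have hM0 : ∀ x, M (0, x) = 0 := by
      intro x
      have h1 := dd_eT_of_eq_pow_smul hA hM h (0, x)
      rw [dd_sqF hF] at h1
      simp only [hmax, pow_zero, Nat.cast_zero, zero_add, one_smul, zero_smul, add_zero] at h1
      rw [← h1]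
      have h2 := hS x
      simp only [Fin.sum_univ_three] at h2 ⊢
      linear_combination (-2 * I) * h2
    obtain ⟨M', hM', h'⟩ := exists_eq_fst_smul hM hM0
    exact ⟨M', hM', fun p => by rw [h, h', smul_smul]; ring_nf⟩
  have hstep : ∀ n : ℕ, ∃ M : ST → ℂ, RealAnalytic M ∧ ∀ p, sqF F p = p.1 ^ (n + 2) • M p := by
    intro n
    induction n with
    | zero => simpa using htwo
    | succ n ih =>
      obtain ⟨M, hM, h⟩ := ih
      set M₁ : ST → ℂ := fun p => (((n + 1 : ℕ) : ℝ) + 1) • M p + p.1 • dd eT M p with hM₁def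
      have hM₁ : RealAnalytic M₁ := fun p hp => by
        have c : AnalyticAt ℝ (fun _ : ST => ((n + 1 : ℕ) : ℝ) + 1) p := analyticAt_const
        exact (c.smul (hM p hp)).add ((realAnalytic_fst p hp).smul (hM.dd eT p hp))
      have h1 : ∀ p, dd eT (sqF F) p = p.1 ^ (n + 1) • M₁ p := dd_eT_of_eq_pow_smul hA hM h
      have h2 := dd_eT_of_eq_pow_smul (hA.dd eT) hM₁ h1
      have h3 := fun i => dd_eX_of_eq_pow_smul hA hM h i
      have h4 := fun i => dd_eX_of_eq_pow_smul (hA.dd (eX i)) (hM.dd (eX i)) (h3 i) i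
      have cM := (hM.contDiff (n := 0)).continuous
      have cM₁ := (hM₁.contDiff (n := 0)).continuous
      have cM₁t := ((hM₁.dd eT).contDiff (n := 0)).continuous
      have cMx := fun i => ((hM.dd (eX i)).contDiff (n := 0)).continuous
      have cMxx := fun i => (((hM.dd (eX i)).dd (eX i)).contDiff (n := 0)).continuous
      have key : ∀ x, F k (0, x) ^ 2 * M (0, x) = 0 := by
        intro x
        -- The wave equation divided by `t ^ n` holds for `t ≠ 0` and extends to `t = 0` by
        -- continuity. There only `(n + 1)(n + 2) Fₖ² M` is left, every other term carrying a
        -- positive power of `t`.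
        have hfun := Continuous.ext_on (dense_compl_singleton (0 : ℝ))
          (f := fun t : ℝ => F k (t, x) ^ 2 * ((((n : ℝ) + 1) • M₁ (t, x) + t • dd eT M₁ (t, x)) -
            ∑ j, t ^ 2 • dd (eX j) (dd (eX j) M) (t, x)))
          (g := fun t : ℝ => α (t, x) * (t ^ 2 • M (t, x)) + γ (t, x) * (t • M₁ (t, x)) +
            ∑ j, β j (t, x) * (t ^ 2 • dd (eX j) M (t, x))) (by fun_prop) (by fun_prop) ?_
        · have h5 := congrFun hfun 0
          simp only [zero_smul, add_zero, ne_eq, OfNat.ofNat_ne_zero, not_false_eq_true, zero_pow,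
            Finset.sum_const_zero, sub_zero, mul_zero, hM₁def, real_smul] at h5
          have hn : ((n : ℂ) + 1) * ((n : ℂ) + 1 + 1) ≠ 0 := by
            exact_mod_cast (by positivity : (n + 1) * (n + 1 + 1) ≠ 0)
          refine (mul_eq_zero.1 ?_).resolve_left hn
          push_cast at h5
          linear_combination h5
        · intro t ht
          have ht' : (t : ℂ) ≠ 0 := by exact_mod_cast ht
          have h5 := heq (t, x)
          rw [h2, h1, h] at h5
          simp only [h4, h3, real_smul, Fin.sum_univ_three] at h5 ⊢
          push_cast at h5 ⊢
          refine mul_left_cancel₀ (pow_ne_zero n ht') ?_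
          linear_combination h5
      have hM0 : ∀ x, M (0, x) = 0 := by
        have han : RealAnalytic fun x : Space => M (0, x) := fun x _ =>
          (hM (0, x) (Set.mem_univ _)).comp (f := fun x : Space => ((0, x) : ST))
            (analyticAt_const.prod analyticAt_id)
        -- Vanishing near the single point `x₀` suffices: analyticity in `x` spreads it over the
        -- zeros of `Fₖ`.
        have hev : (fun x : Space => M (0, x)) =ᶠ[𝓝 x₀] 0 := by
          have : ∀ᶠ x in 𝓝 x₀, F k (0, x) ≠ 0 :=
            (hcF.comp (Continuous.prodMk_right 0)).continuousAt.eventually_ne hx₀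
          filter_upwards [this] with x hx
          exact (mul_eq_zero.1 (key x)).resolve_left (pow_ne_zero 2 hx)
        intro x
        exact han.eqOn_zero_of_preconnected_of_eventuallyEq_zero isPreconnected_univ
          (Set.mem_univ x₀) hev (Set.mem_univ x)
      obtain ⟨M', hM', h'⟩ := exists_eq_fst_smul hM hM0
      exact ⟨M', hM', fun p => by rw [h, h', smul_smul]; ring_nf⟩
  refine eq_zero_of_forall_pow_smul hA (fun m => ?_) p
  match m with
  | 0 => exact ⟨sqF F, hA, fun p => by simp⟩
  | 1 => exact hone
  | n + 2 => exact hstep n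

end NullPropagation

/-! ### Shear-free, conformal-foliation and curl conditions at a point. -/

section PointwiseEquivalence

variable {E B : Space → Fin 3 → ℝ}

lemma rs_dot_rs (E B : Space → Fin 3 → ℝ) (x : Space) :
    rs E B x ⬝ᵥ rs E B x =
      ((E x ⬝ᵥ E x - B x ⬝ᵥ B x : ℝ) : ℂ) + Complex.I * ((2 * E x ⬝ᵥ B x : ℝ) : ℂ) := by
  simp only [dotProduct, rs, Fin.sum_univ_three]
  push_cast
  linear_combination ((B x 0 : ℂ) ^ 2 + (B x 1 : ℂ) ^ 2 + (B x 2 : ℂ) ^ 2) * Complex.I_sq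

lemma ofReal_add_I_mul_eq_zero {a b : ℝ} : (a : ℂ) + Complex.I * b = 0 ↔ a = 0 ∧ b = 0 := by
  rw [Complex.ext_iff]
  simp

lemma IsNull.dot_self (h : IsNull E B) (x : Space) : E x ⬝ᵥ E x = B x ⬝ᵥ B x := by
  have := h x
  rw [rs_dot_rs, ofReal_add_I_mul_eq_zero] at this
  linarith [this.1]

lemma IsNull.dot (h : IsNull E B) (x : Space) : E x ⬝ᵥ B x = 0 := by
  have := h x
  rw [rs_dot_rs, ofReal_add_I_mul_eq_zero] at this
  linarith [this.2]

lemma pd_mul_of_differentiableAt {f g : Space → ℝ} {x : Space} (hf : DifferentiableAt ℝ f x)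
    (hg : DifferentiableAt ℝ g x) (j : Fin 3) :
    pd j (fun y => f y * g y) x = f x * pd j g x + pd j f x * g x := by
  simp [pd, fderiv_fun_mul hf hg, mul_comm (g x)]

lemma pd_dot {U V : Space → Fin 3 → ℝ} {x : Space}
    (hU : ∀ i, DifferentiableAt ℝ (fun y => U y i) x)
    (hV : ∀ i, DifferentiableAt ℝ (fun y => V y i) x) (j : Fin 3) :
    pd j (fun y => U y ⬝ᵥ V y) x =
      ∑ i, (U x i * pd j (fun y => V y i) x + pd j (fun y => U y i) x * V x i) := by
  have h : pd j (fun y => ∑ i, U y i * V y i) x = ∑ i, pd j (fun y => U y i * V y i) x := by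
    simp [pd, fderiv_fun_sum fun i _ => (hU i).fun_mul (hV i)]
  refine h.trans (Finset.sum_congr rfl fun i _ => ?_)
  exact pd_mul_of_differentiableAt (hU i) (hV i) j

lemma curl_rs (hE : ∀ i, Differentiable ℝ fun y => E y i)
    (hB : ∀ i, Differentiable ℝ fun y => B y i)
    (x : Space) :
    curl (rs E B) x = fun i => ((curl E x i : ℝ) : ℂ) + Complex.I * ((curl B x i : ℝ) : ℂ) := by
  have h : ∀ i j, pd j (fun y => rs E B y i) x =
      ((pd j (fun y => E y i) x : ℝ) : ℂ) + Complex.I * ((pd j (fun y => B y i) x : ℝ) : ℂ) := by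
    intro i j
    have h1 : HasFDerivAt (fun y => (E y i : ℂ))
        (Complex.ofRealCLM.comp (fderiv ℝ (fun y => E y i) x)) x :=
      Complex.ofRealCLM.hasFDerivAt.comp x (hE i x).hasFDerivAt
    have h2 : HasFDerivAt (fun y => (B y i : ℂ))
        (Complex.ofRealCLM.comp (fderiv ℝ (fun y => B y i) x)) x :=
      Complex.ofRealCLM.hasFDerivAt.comp x (hB i x).hasFDerivAt
    have h3 : HasFDerivAt (fun y => rs E B y i) _ x := h1.add (h2.const_mul Complex.I)
    rw [pd, h3.fderiv]
    simp [pd]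
  funext i
  simp only [curl_apply, h]
  push_cast
  ring

lemma rs_dot_curl_rs_eq_zero_iff (hE : ∀ i, Differentiable ℝ fun y => E y i)
    (hB : ∀ i, Differentiable ℝ fun y => B y i) (x : Space) :
    rs E B x ⬝ᵥ curl (rs E B) x = 0 ↔
      E x ⬝ᵥ curl E x - B x ⬝ᵥ curl B x = 0 ∧ E x ⬝ᵥ curl B x + B x ⬝ᵥ curl E x = 0 := by
  have : rs E B x ⬝ᵥ curl (rs E B) x = ((E x ⬝ᵥ curl E x - B x ⬝ᵥ curl B x : ℝ) : ℂ) +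
      Complex.I * ((E x ⬝ᵥ curl B x + B x ⬝ᵥ curl E x : ℝ) : ℂ) := by
    rw [curl_rs hE hB]
    simp only [dotProduct, rs, Fin.sum_univ_three]
    push_cast
    linear_combination ((B x 0 : ℂ) * ((curl B x 0 : ℝ) : ℂ) +
      (B x 1 : ℂ) * ((curl B x 1 : ℝ) : ℂ) +
      (B x 2 : ℂ) * ((curl B x 2 : ℝ) : ℂ)) * Complex.I_sq
  rw [this, ofReal_add_I_mul_eq_zero]

lemma IsNull.sum_pd_sub (hE : ∀ i, Differentiable ℝ fun y => E y i)
    (hB : ∀ i, Differentiable ℝ fun y => B y i) (h : IsNull E B) (x : Space) (j : Fin 3) :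
    ∑ i, (E x i * pd j (fun y => E y i) x - B x i * pd j (fun y => B y i) x) = 0 := by
  have h1 : (fun y => E y ⬝ᵥ E y) = fun y => B y ⬝ᵥ B y := funext h.dot_self
  have h2 := pd_dot (fun i => hE i x) (fun i => hE i x) j
  rw [h1, pd_dot (fun i => hB i x) (fun i => hB i x) j] at h2
  simp only [Fin.sum_univ_three] at h2 ⊢
  linarith

lemma IsNull.sum_pd_add (hE : ∀ i, Differentiable ℝ fun y => E y i)
    (hB : ∀ i, Differentiable ℝ fun y => B y i) (h : IsNull E B) (x : Space) (j : Fin 3) :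
    ∑ i, (E x i * pd j (fun y => B y i) x + B x i * pd j (fun y => E y i) x) = 0 := by
  have h1 : (fun y => E y ⬝ᵥ B y) = fun _ => 0 := funext h.dot
  have h2 := pd_dot (fun i => hE i x) (fun i => hB i x) j
  have h3 : pd j (fun _ : Space => (0 : ℝ)) x = 0 := by simp [pd]
  rw [h1, h3] at h2
  simp only [Fin.sum_univ_three] at h2 ⊢
  linarith

lemma dot_eq_zero_of_energy {x : Space} (h : energy E B x = 0) : E x = 0 ∧ B x = 0 := by
  have h1 : 0 ≤ E x ⬝ᵥ E x := Finset.sum_nonneg fun i _ => mul_self_nonneg _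
  have h2 : 0 ≤ B x ⬝ᵥ B x := Finset.sum_nonneg fun i _ => mul_self_nonneg _
  rw [energy] at h
  exact ⟨dotProduct_self_eq_zero.1 (by linarith), dotProduct_self_eq_zero.1 (by linarith)⟩

lemma poynting_dot_left (E B : Space → Fin 3 → ℝ) (x : Space) : poynting E B x ⬝ᵥ E x = 0 := by
  rw [poynting, smul_dotProduct, dotProduct_comm, dot_self_cross, smul_zero]

lemma poynting_dot_right (E B : Space → Fin 3 → ℝ) (x : Space) : poynting E B x ⬝ᵥ B x = 0 := by
  rw [poynting, smul_dotProduct, dotProduct_comm, dot_cross_self, smul_zero]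

lemma differentiableAt_poynting (hE : ∀ i, Differentiable ℝ fun y => E y i)
    (hB : ∀ i, Differentiable ℝ fun y => B y i) {x : Space} (hW : energy E B x ≠ 0) (i : Fin 3) :
    DifferentiableAt ℝ (fun y => poynting E B y i) x := by
  have e : ∀ i, DifferentiableAt ℝ (fun y => E y i) x := fun i => hE i x
  have b : ∀ i, DifferentiableAt ℝ (fun y => B y i) x := fun i => hB i x
  have hW' : DifferentiableAt ℝ (energy E B) x := by
    have : energy E B = fun y => (∑ i, E y i * E y i + ∑ i, B y i * B y i) / 2 := rfl
    rw [this]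
    fun_prop
  have hc : DifferentiableAt ℝ (fun y => crossProduct (E y) (B y) i) x := by
    have : (fun y => crossProduct (E y) (B y) i) =
        fun y => E y (i + 1) * B y (i + 2) - E y (i + 2) * B y (i + 1) := by
      funext y
      rw [cross_apply]
      fin_cases i <;> rfl
    rw [this]
    fun_prop
  exact (hW'.inv hW).mul hc

/-- Differentiating `V · E = V · B = 0` gives `E · ∂ⱼV = -V · ∂ⱼE` and likewise for `B`. Contracting
with `Eʲ` and `Bʲ` turns each shear expression into minus a foliation expression, the two occurring
in opposite order. -/
lemma shearFreeAt_iff (hE : ∀ i, Differentiable ℝ fun y => E y i)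
    (hB : ∀ i, Differentiable ℝ fun y => B y i) {x : Space} (hW : energy E B x ≠ 0) :
    ShearFreeAt E B x ↔ ConformalFoliationAt E B x := by
  have hV := fun i => differentiableAt_poynting hE hB hW i
  have h0 : ∀ j, pd j (fun _ : Space => (0 : ℝ)) x = 0 := fun j => by simp [pd]
  have hVE := fun j => pd_dot hV (fun i => hE i x) j
  have hVB := fun j => pd_dot hV (fun i => hB i x) j
  simp only [poynting_dot_left, poynting_dot_right, h0] at hVE hVB
  have hE0 := hVE 0
  have hE1 := hVE 1
  have hE2 := hVE 2
  have hB0 := hVB 0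
  have hB1 := hVB 1
  have hB2 := hVB 2
  rw [ShearFreeAt, ConformalFoliationAt, and_comm]
  refine and_congr ?_ ?_ <;> rw [← neg_eq_zero] <;>
    refine Eq.congr_left ?_ <;>
    simp only [along, dotProduct, Fin.sum_univ_three, Pi.add_apply, Pi.sub_apply] at *
  · linear_combination E x 0 * hB0 + E x 1 * hB1 + E x 2 * hB2 + B x 0 * hE0 + B x 1 * hE1 +
      B x 2 * hE2
  · linear_combination E x 0 * hE0 + E x 1 * hE1 + E x 2 * hE2 - B x 0 * hB0 - B x 1 * hB1 -
      B x 2 * hB2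

/-- Since `∇ (E · B) = 0`, `(E · ∇)B + (B · ∇)E = -E × (∇ × B) - B × (∇ × E)`. Pairing with `E × B`
and using `E · B = 0`, `E² = B² = W` leaves `W (E · ∇ × E - B · ∇ × B)`, that is `W` times the real
part of `F · ∇ × F`. In the same way `∇ (E² - B²) = 0` yields the imaginary part, up to sign. -/
lemma conformalFoliationAt_iff (hE : ∀ i, Differentiable ℝ fun y => E y i)
    (hB : ∀ i, Differentiable ℝ fun y => B y i) (h : IsNull E B) {x : Space}
    (hW : energy E B x ≠ 0) :
    ConformalFoliationAt E B x ↔ rs E B x ⬝ᵥ curl (rs E B) x = 0 := by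
  rw [rs_dot_curl_rs_eq_zero_iff hE hB, ConformalFoliationAt]
  have d1 := fun j => h.sum_pd_sub hE hB x j
  have d2 := fun j => h.sum_pd_add hE hB x j
  have hd := h.dot x
  have hs := h.dot_self x
  have k1 : poynting E B x ⬝ᵥ (along (E x) B x + along (B x) E x) =
      E x ⬝ᵥ curl E x - B x ⬝ᵥ curl B x := by
    rw [poynting, smul_dotProduct, smul_eq_mul, inv_mul_eq_iff_eq_mul₀ hW]
    have a0 := d2 0
    have a1 := d2 1
    have a2 := d2 2
    simp only [energy, along, curl, cross_apply, dotProduct, Fin.sum_univ_three, Pi.add_apply,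
      Matrix.cons_val] at *
    linear_combination (E x 1 * B x 2 - E x 2 * B x 1) * a0 + (E x 2 * B x 0 - E x 0 * B x 2) * a1
      + (E x 0 * B x 1 - E x 1 * B x 0) * a2
      + (E x 0 * (pd 1 (fun y => B y 2) x - pd 2 (fun y => B y 1) x)
        + E x 1 * (pd 2 (fun y => B y 0) x - pd 0 (fun y => B y 2) x)
        + E x 2 * (pd 0 (fun y => B y 1) x - pd 1 (fun y => B y 0) x)
        - B x 0 * (pd 1 (fun y => E y 2) x - pd 2 (fun y => E y 1) x)
        - B x 1 * (pd 2 (fun y => E y 0) x - pd 0 (fun y => E y 2) x)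
        - B x 2 * (pd 0 (fun y => E y 1) x - pd 1 (fun y => E y 0) x)) * hd
      - (B x 0 * (pd 1 (fun y => B y 2) x - pd 2 (fun y => B y 1) x)
        + B x 1 * (pd 2 (fun y => B y 0) x - pd 0 (fun y => B y 2) x)
        + B x 2 * (pd 0 (fun y => B y 1) x - pd 1 (fun y => B y 0) x)
        + E x 0 * (pd 1 (fun y => E y 2) x - pd 2 (fun y => E y 1) x)
        + E x 1 * (pd 2 (fun y => E y 0) x - pd 0 (fun y => E y 2) x)
        + E x 2 * (pd 0 (fun y => E y 1) x - pd 1 (fun y => E y 0) x)) / 2 * hs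
  have k2 : poynting E B x ⬝ᵥ (along (E x) E x - along (B x) B x) =
      -(E x ⬝ᵥ curl B x + B x ⬝ᵥ curl E x) := by
    rw [poynting, smul_dotProduct, smul_eq_mul, inv_mul_eq_iff_eq_mul₀ hW]
    have a0 := d1 0
    have a1 := d1 1
    have a2 := d1 2
    simp only [energy, along, curl, cross_apply, dotProduct, Fin.sum_univ_three, Pi.sub_apply,
      Matrix.cons_val] at *
    linear_combination (E x 1 * B x 2 - E x 2 * B x 1) * a0 + (E x 2 * B x 0 - E x 0 * B x 2) * a1
      + (E x 0 * B x 1 - E x 1 * B x 0) * a2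
      + (E x 0 * (pd 1 (fun y => E y 2) x - pd 2 (fun y => E y 1) x)
        + E x 1 * (pd 2 (fun y => E y 0) x - pd 0 (fun y => E y 2) x)
        + E x 2 * (pd 0 (fun y => E y 1) x - pd 1 (fun y => E y 0) x)
        + B x 0 * (pd 1 (fun y => B y 2) x - pd 2 (fun y => B y 1) x)
        + B x 1 * (pd 2 (fun y => B y 0) x - pd 0 (fun y => B y 2) x)
        + B x 2 * (pd 0 (fun y => B y 1) x - pd 1 (fun y => B y 0) x)) * hd
      - (B x 0 * (pd 1 (fun y => E y 2) x - pd 2 (fun y => E y 1) x)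
        + B x 1 * (pd 2 (fun y => E y 0) x - pd 0 (fun y => E y 2) x)
        + B x 2 * (pd 0 (fun y => E y 1) x - pd 1 (fun y => E y 0) x)
        - E x 0 * (pd 1 (fun y => B y 2) x - pd 2 (fun y => B y 1) x)
        - E x 1 * (pd 2 (fun y => B y 0) x - pd 0 (fun y => B y 2) x)
        - E x 2 * (pd 0 (fun y => B y 1) x - pd 1 (fun y => B y 0) x)) / 2 * hs
  rw [k1, k2, neg_eq_zero]

/-- For null data the shear-free conditions, the conformal-foliation conditions and
`F · ∇ × F = 0` are equivalent at each point. -/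
theorem shearFree_conformalFoliation_iff (hE : ∀ i, Differentiable ℝ fun y => E y i)
    (hB : ∀ i, Differentiable ℝ fun y => B y i) (h : IsNull E B) (x : Space) :
    (ShearFreeAt E B x ↔ ConformalFoliationAt E B x) ∧
      (ConformalFoliationAt E B x ↔ rs E B x ⬝ᵥ curl (rs E B) x = 0) := by
  -- Where `W = 0`, both fields vanish and `0⁻¹ = 0` makes `V = 0`, so all three conditions hold
  -- whatever the derivative of `V` may be.
  by_cases hW : energy E B x = 0
  · obtain ⟨hE0, hB0⟩ := dot_eq_zero_of_energy hW
    have h1 : ShearFreeAt E B x := by simp [ShearFreeAt, hE0, hB0]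
    have h2 : ConformalFoliationAt E B x := by simp [ConformalFoliationAt, poynting, hW]
    have h3 : rs E B x = 0 := by funext i; simp [rs, hE0, hB0]
    simp [h1, h2, h3]
  · exact ⟨shearFreeAt_iff hE hB hW, conformalFoliationAt_iff hE hB h hW⟩

end PointwiseEquivalence

/-! ### Uniqueness of solutions for given initial data. -/

section Uniqueness

variable {r : WithTop ℕ∞} {J : Set ℝ} {E B E' B' : ℝ → Space → Fin 3 → ℝ}

lemma IsMaxwellSolution.of_le (h : IsMaxwellSolution r J E B) (hr : 1 ≤ r) :
    IsMaxwellSolution 1 J E B :=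
  ⟨h.contDiffOn_E.of_le hr, h.contDiffOn_B.of_le hr, h.div_E, h.div_B, h.ampere, h.faraday⟩

lemma hasDerivAt_of_contDiffOn_univ {U : ℝ → Space → Fin 3 → ℝ}
    (hU : ContDiffOn ℝ 1 (fun p : ST => U p.1 p.2) (Set.univ ×ˢ Set.univ)) (t : ℝ) (x : Space) :
    HasDerivAt (fun s => U s x) (deriv (fun s => U s x) t) t := by
  rw [Set.univ_prod_univ, contDiffOn_univ] at hU
  have h1 : ContDiff ℝ 1 fun s : ℝ => U s x := hU.comp (contDiff_prodMk_left x)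
  exact (h1.differentiable one_ne_zero t).hasDerivAt

lemma IsMaxwellSolution.restrict (h : IsMaxwellSolution 1 Set.univ E B) :
    IsMaxwellSolution 1 (Set.Ici 0) E B where
  contDiffOn_E := h.contDiffOn_E.mono (Set.prod_mono (Set.subset_univ _) subset_rfl)
  contDiffOn_B := h.contDiffOn_B.mono (Set.prod_mono (Set.subset_univ _) subset_rfl)
  div_E t _ := h.div_E t (Set.mem_univ _)
  div_B t _ := h.div_B t (Set.mem_univ _)
  ampere t ht x := by
    rw [← h.ampere t (Set.mem_univ _) x, derivWithin_univ]
    exact (hasDerivAt_of_contDiffOn_univ h.contDiffOn_E t x).hasDerivWithinAt.derivWithin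
      (uniqueDiffOn_Ici 0 t ht)
  faraday t ht x := by
    rw [← h.faraday t (Set.mem_univ _) x, derivWithin_univ]
    exact (hasDerivAt_of_contDiffOn_univ h.contDiffOn_B t x).hasDerivWithinAt.derivWithin
      (uniqueDiffOn_Ici 0 t ht)

lemma pd_neg (f : Space → ℝ) (j : Fin 3) (x : Space) : pd j (fun y => -f y) x = -pd j f x := by
  simp [pd]

lemma curl_neg (V : Space → Fin 3 → ℝ) (x : Space) : curl (fun y => -V y) x = -curl V x := by
  funext i
  simp only [curl_apply, Pi.neg_apply, pd_neg]
  ring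

/-- Reversing time preserves the equations only if the magnetic field changes sign. Negative times
are thereby reduced to positive ones. -/
lemma IsMaxwellSolution.timeReverse (h : IsMaxwellSolution 1 Set.univ E B) :
    IsMaxwellSolution 1 Set.univ (fun t => E (-t)) (fun t x => -B (-t) x) where
  contDiffOn_E := by
    have h1 := h.contDiffOn_E
    rw [Set.univ_prod_univ, contDiffOn_univ] at h1 ⊢
    exact h1.comp (contDiff_fst.neg.prodMk contDiff_snd)
  contDiffOn_B := by
    have h1 := h.contDiffOn_B
    rw [Set.univ_prod_univ, contDiffOn_univ] at h1 ⊢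
    exact (h1.comp (contDiff_fst.neg.prodMk contDiff_snd)).neg
  div_E t _ := h.div_E (-t) (Set.mem_univ _)
  div_B t _ x := by
    have := h.div_B (-t) (Set.mem_univ _) x
    simp only [div, Pi.neg_apply, pd_neg, Finset.sum_neg_distrib] at this ⊢
    rw [this, neg_zero]
  ampere t _ x := by
    have := h.ampere (-t) (Set.mem_univ _) x
    rw [derivWithin_univ] at this ⊢
    rw [curl_neg, ← this]
    exact deriv_comp_neg (fun s => E s x) t
  faraday t _ x := by
    have := h.faraday (-t) (Set.mem_univ _) x
    rw [derivWithin_univ] at this ⊢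
    rw [← this, deriv.fun_neg, deriv_comp_neg (fun s => B s x) t, neg_neg]

lemma contDiffOn_component {U : ℝ → Space → Fin 3 → ℝ}
    (hU : ContDiffOn ℝ 1 (fun p : ST => U p.1 p.2) future) (i : Fin 3) :
    ContDiffOn ℝ 1 (fun p : ST => U p.1 p.2 i) future :=
  contDiffOn_pi.1 hU i

lemma derivWithin_component {U : ℝ → Space → Fin 3 → ℝ}
    (hU : ContDiffOn ℝ 1 (fun p : ST => U p.1 p.2) future) {p : ST} (hp : 0 < p.1) (i : Fin 3) :
    derivWithin (fun s => U s p.2) (Set.Ici 0) p.1 i = dd eT (fun p : ST => U p.1 p.2 i) p := by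
  have h1 : HasDerivAt (fun s => U s p.2) (fun i => dd eT (fun p : ST => U p.1 p.2 i) p) p.1 :=
    hasDerivAt_pi.2 fun i => hasDerivAt_time (contDiffOn_component hU i) hp p.2
  rw [h1.hasDerivWithinAt.derivWithin (uniqueDiffOn_Ici 0 p.1 hp.le)]

lemma curl_component {U : ℝ → Space → Fin 3 → ℝ}
    (hU : ContDiffOn ℝ 1 (fun p : ST => U p.1 p.2) future) {p : ST} (hp : 0 < p.1) (i : Fin 3) :
    curl (U p.1) p.2 i = stCurl (fun j (p : ST) => U p.1 p.2 j) i p := by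
  have h : ∀ i j, pd i (fun y => U p.1 y j) p.2 = dd (eX i) (fun p : ST => U p.1 p.2 j) p := by
    intro i j
    have h1 := hasFDerivAt_space (contDiffOn_component hU j) hp p.2
    rw [pd, h1.fderiv]
    rfl
  rw [curl_apply, h, h, stCurl]

lemma stCurl_sub {f g : Fin 3 → ST → ℝ} {p : ST} (hf : ∀ i, DifferentiableAt ℝ (f i) p)
    (hg : ∀ i, DifferentiableAt ℝ (g i) p) (i : Fin 3) :
    stCurl (fun j q => f j q - g j q) i p = stCurl f i p - stCurl g i p := by
  simp only [stCurl, dd, fderiv_fun_sub (hf _) (hg _), sub_apply]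
  ring

lemma IsMaxwellSolution.eq_of_nonneg (h : IsMaxwellSolution 1 (Set.Ici 0) E B)
    (h' : IsMaxwellSolution 1 (Set.Ici 0) E' B') (hE : E 0 = E' 0) (hB : B 0 = B' 0) {t : ℝ}
    (ht : 0 ≤ t) : E t = E' t ∧ B t = B' t := by
  have cE := contDiffOn_component h.contDiffOn_E
  have cB := contDiffOn_component h.contDiffOn_B
  have cE' := contDiffOn_component h'.contDiffOn_E
  have cB' := contDiffOn_component h'.contDiffOn_B
  have key := eq_zero_of_initial_eq_zero
    (e := fun i p => E p.1 p.2 i - E' p.1 p.2 i) (b := fun i p => B p.1 p.2 i - B' p.1 p.2 i)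
    (fun i => (cE i).sub (cE' i)) (fun i => (cB i).sub (cB' i))
    (fun i p hp => by
      have d := fun i => differentiableAt_of_pos (cB i) hp
      have d' := fun i => differentiableAt_of_pos (cB' i) hp
      rw [stCurl_sub d d', ← curl_component h.contDiffOn_B hp, ← curl_component h'.contDiffOn_B hp,
        ← h.ampere p.1 hp.le, ← h'.ampere p.1 hp.le, derivWithin_component h.contDiffOn_E hp,
        derivWithin_component h'.contDiffOn_E hp, dd, fderiv_fun_sub
          (differentiableAt_of_pos (cE i) hp) (differentiableAt_of_pos (cE' i) hp)]
      rfl)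
    (fun i p hp => by
      have d := fun i => differentiableAt_of_pos (cE i) hp
      have d' := fun i => differentiableAt_of_pos (cE' i) hp
      have f1 := congrFun (h.faraday p.1 hp.le p.2) i
      have f2 := congrFun (h'.faraday p.1 hp.le p.2) i
      rw [derivWithin_component h.contDiffOn_B hp, Pi.neg_apply,
        curl_component h.contDiffOn_E hp] at f1
      rw [derivWithin_component h'.contDiffOn_B hp, Pi.neg_apply,
        curl_component h'.contDiffOn_E hp] at f2
      rw [stCurl_sub d d', neg_sub', ← f1, ← f2, dd, fderiv_fun_sub
          (differentiableAt_of_pos (cB i) hp) (differentiableAt_of_pos (cB' i) hp)]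
      rfl)
    (fun i x => by simp [hE]) (fun i x => by simp [hB]) ht
  exact ⟨funext fun x => funext fun i => sub_eq_zero.1 (key x i).1,
    funext fun x => funext fun i => sub_eq_zero.1 (key x i).2⟩

/-- Solutions of Maxwell's equations are determined by their initial data. -/
theorem IsMaxwellSolution.unique (hJ : J = Set.Ici 0 ∨ J = Set.univ) (hr : 1 ≤ r)
    (h : IsMaxwellSolution r J E B) (h' : IsMaxwellSolution r J E' B') (hE : E 0 = E' 0)
    (hB : B 0 = B' 0) {t : ℝ} (ht : t ∈ J) : E t = E' t ∧ B t = B' t := by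
  have h := h.of_le hr
  have h' := h'.of_le hr
  rcases hJ with rfl | rfl
  · exact h.eq_of_nonneg h' hE hB ht
  · rcases le_total 0 t with h0 | h0
    · exact h.restrict.eq_of_nonneg h'.restrict hE hB h0
    · have := h.timeReverse.restrict.eq_of_nonneg h'.timeReverse.restrict (by simpa using hE)
        (by simp [hB]) (neg_nonneg.2 h0)
      simp only [neg_neg] at this
      exact ⟨this.1, funext fun x => neg_injective (congrFun this.2 x)⟩

end Uniqueness

/-! ### Null analytic solutions in complex form. -/

section NullSolutions

open Complex

variable {e b : Fin 3 → ST → ℝ}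

/-- The components of the Riemann–Silberstein vector. -/
def rsST (e b : Fin 3 → ST → ℝ) (i : Fin 3) (p : ST) : ℂ := (e i p : ℂ) + I * (b i p : ℂ)

lemma realAnalytic_rsST (he : ∀ i, RealAnalytic (e i)) (hb : ∀ i, RealAnalytic (b i)) (i : Fin 3) :
    RealAnalytic (rsST e b i) := fun p hp =>
  ((ofRealCLM.analyticAt _).comp (he i p hp)).add
    (analyticAt_const.mul ((ofRealCLM.analyticAt _).comp (hb i p hp)))

lemma dd_rsST (he : ∀ i, RealAnalytic (e i)) (hb : ∀ i, RealAnalytic (b i)) (v : ST) (i : Fin 3)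
    (p : ST) : dd v (rsST e b i) p = ((dd v (e i) p : ℝ) : ℂ) + I * ((dd v (b i) p : ℝ) : ℂ) := by
  have h1 : HasFDerivAt (fun p => (e i p : ℂ)) (ofRealCLM.comp (fderiv ℝ (e i) p)) p :=
    ofRealCLM.hasFDerivAt.comp p ((he i).differentiable p).hasFDerivAt
  have h2 : HasFDerivAt (fun p => (b i p : ℂ)) (ofRealCLM.comp (fderiv ℝ (b i) p)) p :=
    ofRealCLM.hasFDerivAt.comp p ((hb i).differentiable p).hasFDerivAt
  have h3 : HasFDerivAt (rsST e b i) _ p := h1.add (h2.const_mul I)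
  rw [dd, h3.fderiv]
  simp [dd]

/-- Covers identically vanishing data, for which no component supplies the point `x₀` that
`sqF_eq_zero` requires. -/
lemma AnalyticMaxwell.eq_zero (h : AnalyticMaxwell e b) (he : ∀ i x, e i (0, x) = 0)
    (hb : ∀ i x, b i (0, x) = 0) (i : Fin 3) (p : ST) : e i p = 0 ∧ b i p = 0 := by
  have hz : AnalyticMaxwell (fun _ _ => 0) (fun _ _ => 0) :=
    ⟨fun _ _ _ => analyticAt_const, fun _ _ _ => analyticAt_const, by simp [dd], by simp [dd],
      by simp [dd, stCurl], by simp [dd, stCurl]⟩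
  have := IsMaxwellSolution.unique (Or.inr rfl) le_rfl (h.isMaxwellSolution 1 uniqueDiffOn_univ)
    (hz.isMaxwellSolution 1 uniqueDiffOn_univ) (by funext x i; exact he i x)
    (by funext x i; exact hb i x) (Set.mem_univ p.1)
  exact ⟨congrFun (congrFun this.1 p.2) i, congrFun (congrFun this.2 p.2) i⟩

lemma AnalyticMaxwell.null_iff (h : AnalyticMaxwell e b) {J : Set ℝ}
    (hJ : J = Set.Ici 0 ∨ J = Set.univ) :
    ((∀ x, sqF (rsST e b) (0, x) = 0) ∧
      ∀ x, ∑ i, rsST e b i (0, x) * stCurl (rsST e b) i (0, x) = 0) ↔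
    ∀ t ∈ J, ∀ x, sqF (rsST e b) (t, x) = 0 := by
  have hF := realAnalytic_rsST h.analytic_e h.analytic_b
  have hd := dd_rsST h.analytic_e h.analytic_b
  have hdiv : ∀ p, ∑ i, dd (eX i) (rsST e b i) p = 0 := by
    intro p
    simp only [hd, Finset.sum_add_distrib, ← Finset.mul_sum, ← ofReal_sum, h.div_e, h.div_b]
    simp
  have hmax : ∀ i p, dd eT (rsST e b i) p = -I * stCurl (rsST e b) i p := by
    intro i p
    simp only [hd, h.ampere, h.faraday, stCurl]
    push_cast
    linear_combination (((dd (eX (i + 1)) (b (i + 2)) p : ℝ) : ℂ) -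
      ((dd (eX (i + 2)) (b (i + 1)) p : ℝ) : ℂ)) * I_sq
  have hsub : Set.Ici (0 : ℝ) ⊆ J := by rcases hJ with rfl | rfl <;> simp
  constructor
  · rintro ⟨h1, h2⟩ t _ x
    by_cases hz : ∃ k x₀, rsST e b k (0, x₀) ≠ 0
    · obtain ⟨k, x₀, hx₀⟩ := hz
      exact sqF_eq_zero hF hdiv hmax h1 h2 hx₀ (t, x)
    · push Not at hz
      have hre : ∀ i x, e i (0, x) = 0 ∧ b i (0, x) = 0 := fun i x => by
        have := hz i x
        rw [rsST, Complex.ext_iff] at this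
        simpa using this
      have := fun i => h.eq_zero (fun i x => (hre i x).1) (fun i x => (hre i x).2) i (t, x)
      simp [sqF, rsST, this]
  · intro hnull
    refine ⟨fun x => hnull 0 (hsub Set.self_mem_Ici) x, fun x => ?_⟩
    -- Nullity may be known for `t ≥ 0` only; the one-sided derivative at `0` already determines
    -- `∂ₜ(F · F)`.
    have h1 : HasDerivWithinAt (fun s => sqF (rsST e b) (s, x)) (dd eT (sqF (rsST e b)) (0, x))
        (Set.Ici 0) 0 := (hasDerivAt_slice (realAnalytic_sqF hF) 0 x).hasDerivWithinAt
    have h2 : HasDerivWithinAt (fun s => sqF (rsST e b) (s, x)) 0 (Set.Ici 0) 0 :=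
      (hasDerivWithinAt_const (0 : ℝ) (Set.Ici 0) (0 : ℂ)).congr
        (fun s hs => hnull s (hsub hs) x) (hnull 0 (hsub Set.self_mem_Ici) x)
    have h3 := (uniqueDiffOn_Ici (0 : ℝ) 0 Set.self_mem_Ici).eq_deriv _ h1 h2
    rw [dd_sqF hF] at h3
    simp only [hmax] at h3
    have h4 : (-2 * I) * ∑ i, rsST e b i (0, x) * stCurl (rsST e b) i (0, x) = 0 := by
      rw [← h3, Finset.mul_sum]
      exact Finset.sum_congr rfl fun i _ => by ring
    exact (mul_eq_zero.1 h4).resolve_left (by simp)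

end NullSolutions

variable {J : Set ℝ} {E₀ B₀ : Space → Fin 3 → ℝ}

lemma uniqueDiffOn_of_eq (hJ : J = Set.Ici 0 ∨ J = Set.univ) : UniqueDiffOn ℝ J := by
  rcases hJ with rfl | rfl
  · exact uniqueDiffOn_Ici 0
  · exact uniqueDiffOn_univ

/-- The analytic solution stays null if and only if the initial data satisfy the two conditions. -/
lemma sol_null_iff (hJ : J = Set.Ici 0 ∨ J = Set.univ)
    (hE₀ : RealAnalytic E₀) (hB₀ : RealAnalytic B₀)
    (hdivE : ∀ x, div E₀ x = 0) (hdivB : ∀ x, div B₀ x = 0) :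
    (IsNull E₀ B₀ ∧ ∀ x, rs E₀ B₀ x ⬝ᵥ curl (rs E₀ B₀) x = 0) ↔
      ∀ t ∈ J, IsNull (fun x i => solE E₀ B₀ i (t, x)) (fun x i => solB E₀ B₀ i (t, x)) := by
  have hsol := analyticMaxwell_sol hE₀ hB₀ hdivE hdivB
  have hF := realAnalytic_rsST hsol.analytic_e hsol.analytic_b
  have hrs : rs E₀ B₀ = fun x i => rsST (solE E₀ B₀) (solB E₀ B₀) i (0, x) := by
    funext x i
    have h1 := congrFun (congrFun (solE_zero hE₀ hB₀) x) i
    have h2 := congrFun (congrFun (solB_zero hE₀ hB₀) x) i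
    rw [rsST, h1, h2, rs]
  have key := hsol.null_iff hJ
  have hN : IsNull E₀ B₀ ↔ ∀ x, sqF (rsST (solE E₀ B₀) (solB E₀ B₀)) (0, x) = 0 := by
    rw [IsNull, hrs]
    rfl
  have hS : (∀ x, rs E₀ B₀ x ⬝ᵥ curl (rs E₀ B₀) x = 0) ↔ ∀ x, ∑ i,
      rsST (solE E₀ B₀) (solB E₀ B₀) i (0, x) *
        stCurl (rsST (solE E₀ B₀) (solB E₀ B₀)) i (0, x) = 0 := by
    rw [hrs]
    simp only [curl_slice hF]
    rfl
  rw [hN, hS]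
  exact key

end NullLight

end

theorem mainTheorem2
    (r : WithTop ℕ∞) (hr : 1 ≤ r)
    (J : Set ℝ) (hJ : J = Set.Ici 0 ∨ J = Set.univ)
    (E₀ B₀ : NullLight.Space → Fin 3 → ℝ)
    (hE₀ : AnalyticOnNhd ℝ E₀ Set.univ) (hB₀ : AnalyticOnNhd ℝ B₀ Set.univ)
    (hdivE₀ : ∀ x, NullLight.div E₀ x = 0) (hdivB₀ : ∀ x, NullLight.div B₀ x = 0) :
    -- every solution with these initial data stays null iff the data satisfy the two conditions
    (∀ E B : ℝ → NullLight.Space → Fin 3 → ℝ,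
      NullLight.IsMaxwellSolution r J E B → E 0 = E₀ → B 0 = B₀ →
        ((NullLight.IsNull E₀ B₀ ∧
            ∀ x, NullLight.rs E₀ B₀ x ⬝ᵥ NullLight.curl (NullLight.rs E₀ B₀) x = 0) ↔
          ∀ t ∈ J, NullLight.IsNull (E t) (B t))) ∧
    -- the data give rise to a global null solution iff they satisfy the two conditions
    ((NullLight.IsNull E₀ B₀ ∧
        ∀ x, NullLight.rs E₀ B₀ x ⬝ᵥ NullLight.curl (NullLight.rs E₀ B₀) x = 0) ↔
      ∃ E B : ℝ → NullLight.Space → Fin 3 → ℝ,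
        NullLight.IsMaxwellSolution r J E B ∧ E 0 = E₀ ∧ B 0 = B₀ ∧
          ∀ t ∈ J, NullLight.IsNull (E t) (B t)) ∧
    -- for null data: shear-free iff conformal foliation iff `F · ∇ × F = 0`
    (NullLight.IsNull E₀ B₀ → ∀ x,
      (NullLight.ShearFreeAt E₀ B₀ x ↔ NullLight.ConformalFoliationAt E₀ B₀ x) ∧
      (NullLight.ConformalFoliationAt E₀ B₀ x ↔
        NullLight.rs E₀ B₀ x ⬝ᵥ NullLight.curl (NullLight.rs E₀ B₀) x = 0)) := by
  have hsol := (NullLight.analyticMaxwell_sol hE₀ hB₀ hdivE₀ hdivB₀).isMaxwellSolution r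
    (NullLight.uniqueDiffOn_of_eq hJ)
  have hE0 := NullLight.solE_zero hE₀ hB₀
  have hB0 := NullLight.solB_zero hE₀ hB₀
  have hnull := NullLight.sol_null_iff hJ hE₀ hB₀ hdivE₀ hdivB₀
  have part1 : ∀ E B : ℝ → NullLight.Space → Fin 3 → ℝ,
      NullLight.IsMaxwellSolution r J E B → E 0 = E₀ → B 0 = B₀ →
        ((NullLight.IsNull E₀ B₀ ∧
            ∀ x, NullLight.rs E₀ B₀ x ⬝ᵥ NullLight.curl (NullLight.rs E₀ B₀) x = 0) ↔
          ∀ t ∈ J, NullLight.IsNull (E t) (B t)) := by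
    intro E B h hE hB
    rw [hnull]
    refine forall₂_congr fun t ht => ?_
    -- By uniqueness the given `C^r` solution is the analytic one, for which the equivalence is
    -- known.
    obtain ⟨h1, h2⟩ := h.unique hJ hr hsol (hE.trans hE0.symm) (hB.trans hB0.symm) ht
    rw [h1, h2]
  refine ⟨part1, ⟨fun h => ⟨_, _, hsol, hE0, hB0, hnull.1 h⟩, ?_⟩, ?_⟩
  · rintro ⟨E, B, h, hE, hB, hN⟩
    exact (part1 E B h hE hB).2 hN
  · intro h x
    exact NullLight.shearFree_conformalFoliation_iff
      (fun i => (NullLight.RealAnalytic.component hE₀ i).differentiable)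
      (fun i => (NullLight.RealAnalytic.component hB₀ i).differentiable) h x
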